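/- Let $1\le p<\infty$ and let $(X,d,\mu)$ be a complete metric space with a Borel measure $\mu$ such that $0<\mu(B)<\infty$ for all balls $B$. Assume that $\mu$ is doubling, i.e. $\mu(B(x,2r))\le C_\mu\,\mu(B(x,r))$ for all $x\in X$, $r>0$, and that $X$ supports a $p$-Poincaré inequality: there are $C>0$, $\lambda\ge1$ such that for all balls $B\subset X$, all $u\in N^{1,p}(X)$ and all upper gradients $g\in L^p(X)$ of $u$, $$\frac1{\mu(B)}\int_B|u-u_B|\,d\mu\le C\,\mathrm{diam}(B)\Bigl(\frac1{\mu(\lambda B)}\int_{\lambda B}g^p\,d\mu\Bigr)^{1/p},$$ where $u_B$ is the mean value of $u$ over $B$. **Domains.** A *domain* is a bounded nonempty connected open set $\Omega\subsetneq X$. It is a *John domain* if there are $C_\Omega\ge1$ and $x_0\in\Omega$ such that every $x\in\Omega$ can be joined to $x_0$ by a rectifiable curve $\gamma:[0,l]\to\Omega$, parameterized by arc length, with $\gamma(0)=x$, $\gamma(l)=x_0$ and $t\le C_\Omega\,\mathrm{dist}(\gamma(t),X\setminus\Omega)$ for $0\le t\le l$. It is an *almost John domain* if for each $r>0$ there is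 a closed set $F\subset\overline\Omega$ such that $\Omega\setminus F$ is a John domain and $\mathcal H^1_\infty(F)<r$, where $\mathcal H^1_\infty(F)=\inf\{\sum_j r_j:F\subset\bigcup_{j=1}^\infty B(x_j,r_j)\}$. **Ends.** A set $E\subsetneq\Omega$ is *acceptable* if it is bounded and connected and $\overline E\cap\partial\Omega\ne\emptyset$. A *chain* is a sequence $\{E_k\}_{k=1}^\infty$ of acceptable sets with $E_{k+1}\subset E_k$ and $\mathrm{dist}(\Omega\cap\partial E_{k+1},\Omega\cap\partial E_k)>0$ for all $k$, and with *impression* $\bigcap_k\overline{E_k}\subset\partial\Omega$. The chain $\{E_k\}$ *divides* $\{F_k\}$ if for each $k$ there is $l$ with $E_l\subset F_k$; chains are equivalent if they divide each other. An *end* $[E_k]$ is an equivalence class of chains; impression and division pass to ends. A *prime end* is an end which is not divisible by any other end; $\partial_P\Omega$ is the set of prime ends. **Topology.** A sequence of points $x_n\in\Omega$ converges to the end $[E_k]$ if for every $k$ we have $x_n\in E_k$ for all large $n$; a sequence of ends $[E^n_k]$ converges to $[E_k]$ if for every $k$ and all large $n$ there is $l$ with $E^n_l\subset E_k$; convergence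 of points to points of $\Omega$ is metric convergence, and no sequence of ends converges to a point of $\Omega$. A set of points and ends is closed if it contains all limits of sequences in it. The *prime end closure* $\overline\Omega^P=\Omega\cup\partial_P\Omega$ has the topology induced by this topology on the union of $\Omega$ and the set of all ends. The *Mazurkiewicz closure* $\overline\Omega^M$ is the completion of $(\Omega,d_M)$, where $d_M(x,y)=\inf\mathrm{diam}\,E$ over all connected sets $E\subset\Omega$ containing $x$ and $y$. **Modulus.** For a family $\Gamma$ of nonconstant rectifiable curves, $\mathrm{Mod}_p(\Gamma)=\inf\int_X\rho^p\,d\mu$ over all Borel $\rho:X\to[0,\infty]$ with $\int_\gamma\rho\,ds\ge1$ for all $\gamma\in\Gamma$; $\mathrm{Mod}_p(E,K,\Omega)$ is the modulus of the family of curves in $\Omega$ from $E$ to $K$. A *$\mathrm{Mod}_p$-end* is an end represented by a chain $\{E_k\}$ with $\lim_{k\to\infty}\mathrm{Mod}_p(E_k,K,\Omega)=0$ for every compact $K\subset\Omega$; it is a *$\mathrm{Mod}_p$-prime end* if the only $\mathrm{Mod}_p$-end dividing it is itself. For $x\in X$, let $Q(x)$ be the set of all $q>0$ for which there are $C_q,R_q>0$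 such that $\mu(B(x,r))/\mu(B(x,R))\le C_q(r/R)^q$ for all $0<r\le R\le R_q$. **Statement.** Let $\Omega$ be an almost John domain. Then: (a) Every end is divisible by some prime end. (b) Every prime end has a singleton impression. (c) Every $x\in\partial\Omega$ is accessible, i.e. there is a continuous $\gamma:[0,1]\to X$ with $\gamma(1)=x$ and $\gamma([0,1))\subset\Omega$; and there is at least one prime end with impression $\{x\}$. (d) There is a homeomorphism $\Phi:\overline\Omega^P\to\overline\Omega^M$ such that $\Phi|_\Omega$ is the identity map. (e) If $p\in Q(x)\ne(0,1]$ for all $x\in\partial\Omega$, then the set of $\mathrm{Mod}_p$-prime ends equals the set $\partial_P\Omega$ of prime ends. (f) The prime end closure $\overline\Omega^P$ is metrizable and compact. -/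

import Mathlib

open Set Filter Topology MeasureTheory
open scoped ENNReal NNReal

namespace PrimeEnds

/-! ### The metric measure space -/

/-- A nonconstant rectifiable curve `[0, len] → X` parameterized by arc length.
Only the restriction of `toFun` to `[0, len]` is relevant. -/
structure RectCurve (X : Type*) [PseudoEMetricSpace X] where
  len : ℝ
  len_pos : 0 < len
  toFun : ℝ → X
  unitSpeed : HasUnitSpeedOn toFun (Icc 0 len)

/-- The arc length integral of `ρ` along `γ`. -/
noncomputable def lineIntegral {X : Type*} [PseudoEMetricSpace X]
    (ρ : X → ℝ≥0∞) (γ : RectCurve X) : ℝ≥0∞ :=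
  ∫⁻ t in Icc 0 γ.len, ρ (γ.toFun t)

/-- `g` is an upper gradient of the function `u`. -/
def IsUpperGradient {X : Type*} [PseudoEMetricSpace X] [MeasurableSpace X]
    (g : X → ℝ≥0∞) (u : X → ℝ) : Prop :=
  Measurable g ∧
    ∀ γ : RectCurve X,
      ENNReal.ofReal |u (γ.toFun 0) - u (γ.toFun γ.len)| ≤ lineIntegral g γ

/-- Balls have positive and finite measure. -/
def BallsPosFinite {X : Type*} [PseudoMetricSpace X] [MeasurableSpace X]
    (μ : Measure X) : Prop :=
  ∀ (x : X) (r : ℝ), 0 < r → 0 < μ (Metric.ball x r) ∧ μ (Metric.ball x r) < ∞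

/-- The measure `μ` is doubling. -/
def IsDoubling {X : Type*} [PseudoMetricSpace X] [MeasurableSpace X]
    (μ : Measure X) : Prop :=
  ∃ C : ℝ≥0, ∀ (x : X) (r : ℝ), 0 < r →
    μ (Metric.ball x (2 * r)) ≤ C * μ (Metric.ball x r)

/-- `(X, μ)` supports a `p`-Poincaré inequality: the inequality holds on all balls, for every
measurable `u` with `∫ |u|^p < ∞` and every upper gradient `g` of `u` with `∫ g^p < ∞`
(so `u` ranges over the Newtonian space `N^{1,p}(X)`). -/
def SupportsPoincare {X : Type*} [PseudoMetricSpace X] [MeasurableSpace X]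
    (μ : Measure X) (p : ℝ) : Prop :=
  ∃ (C L : ℝ≥0), 1 ≤ L ∧
    ∀ (u : X → ℝ) (g : X → ℝ≥0∞), AEMeasurable u μ → ∫⁻ x, ‖u x‖ₑ ^ p ∂μ < ∞ →
      IsUpperGradient g u → ∫⁻ x, g x ^ p ∂μ < ∞ →
      ∀ (z : X) (r : ℝ), 0 < r →
        ⨍⁻ x in Metric.ball z r, ‖u x - ⨍ y in Metric.ball z r, u y ∂μ‖ₑ ∂μ ≤
          C * Metric.ediam (Metric.ball z r) *
            (⨍⁻ x in Metric.ball z (L * r), g x ^ p ∂μ) ^ (1 / p)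

/-- The pointwise dimension set `Q(x)`. -/
def dimSet {X : Type*} [PseudoMetricSpace X] [MeasurableSpace X]
    (μ : Measure X) (x : X) : Set ℝ :=
  {q | 0 < q ∧ ∃ C : ℝ, 0 < C ∧ ∃ R₀ : ℝ, 0 < R₀ ∧
    ∀ r R : ℝ, 0 < r → r ≤ R → R ≤ R₀ →
      μ.real (Metric.ball x r) / μ.real (Metric.ball x R) ≤ C * (r / R) ^ q}

/-- The `p`-modulus of a family of curves. -/
noncomputable def modulus {X : Type*} [PseudoEMetricSpace X] [MeasurableSpace X]
    (μ : Measure X) (p : ℝ) (Γ : Set (RectCurve X)) : ℝ≥0∞ :=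
  ⨅ (ρ : X → ℝ≥0∞) (_ : Measurable ρ) (_ : ∀ γ ∈ Γ, 1 ≤ lineIntegral ρ γ),
    ∫⁻ x, ρ x ^ p ∂μ

/-- The family `Γ(E, F, U)` of curves in `U` which start in `E` and end in `F`. -/
def curvesJoining {X : Type*} [PseudoEMetricSpace X] (E F U : Set X) : Set (RectCurve X) :=
  {γ | (∀ t ∈ Icc 0 γ.len, γ.toFun t ∈ U) ∧ γ.toFun 0 ∈ E ∧ γ.toFun γ.len ∈ F}

/-! ### Domains -/

/-- `Ω ⊊ X` is a bounded domain. -/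
def IsBoundedDomain {X : Type*} [PseudoMetricSpace X] (Ω : Set X) : Prop :=
  IsOpen Ω ∧ IsConnected Ω ∧ Bornology.IsBounded Ω ∧ Ω ≠ univ

/-- `Ω` is a John domain. The constant curve is allowed as John curve of the John center. -/
def IsJohnDomain {X : Type*} [PseudoMetricSpace X] (Ω : Set X) : Prop :=
  IsBoundedDomain Ω ∧
    ∃ C : ℝ, 1 ≤ C ∧ ∃ x₀ ∈ Ω, ∀ x ∈ Ω, ∃ (l : ℝ) (γ : ℝ → X),
      0 ≤ l ∧ HasUnitSpeedOn γ (Icc 0 l) ∧ γ 0 = x ∧ γ l = x₀ ∧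
        ∀ t ∈ Icc 0 l, γ t ∈ Ω ∧ t ≤ C * Metric.infDist (γ t) Ωᶜ

/-- The `s`-dimensional Hausdorff content. -/
noncomputable def hausdorffContent {X : Type*} [PseudoMetricSpace X] (s : ℝ) (E : Set X) :
    ℝ≥0∞ :=
  ⨅ (x : ℕ → X) (r : ℕ → ℝ) (_ : ∀ j, 0 < r j) (_ : E ⊆ ⋃ j, Metric.ball (x j) (r j)),
    ∑' j, ENNReal.ofReal (r j) ^ s

/-- `Ω` is an almost John domain. -/
def IsAlmostJohnDomain {X : Type*} [PseudoMetricSpace X] (Ω : Set X) : Prop :=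
  IsBoundedDomain Ω ∧
    ∀ r : ℝ, 0 < r → ∃ F : Set X, IsClosed F ∧ F ⊆ closure Ω ∧
      hausdorffContent 1 F < ENNReal.ofReal r ∧ IsJohnDomain (Ω \ F)

/-- `x` is an accessible boundary point of `Ω`. -/
def IsAccessible {X : Type*} [TopologicalSpace X] (Ω : Set X) (x : X) : Prop :=
  x ∈ frontier Ω ∧
    ∃ γ : ℝ → X, ContinuousOn γ (Icc 0 1) ∧ γ 1 = x ∧ ∀ t ∈ Ico (0 : ℝ) 1, γ t ∈ Ω

/-! ### Ends and prime ends -/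

/-- Acceptable sets: bounded connected `E ⊊ Ω` whose closure meets the boundary of `Ω`. -/
def IsAcceptable {X : Type*} [PseudoMetricSpace X] (Ω E : Set X) : Prop :=
  E ⊂ Ω ∧ Bornology.IsBounded E ∧ IsConnected E ∧ (closure E ∩ frontier Ω).Nonempty

/-- Chains of acceptable sets (indexed from `0`).
`Metric.AreSeparated` says that the distance of the two sets is positive. -/
structure EndChain {X : Type*} [PseudoMetricSpace X] (Ω : Set X) where
  sets : ℕ → Set X
  acceptable : ∀ k, IsAcceptable Ω (sets k)
  succ_subset : ∀ k, sets (k + 1) ⊆ sets k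
  separated : ∀ k,
    Metric.AreSeparated (Ω ∩ frontier (sets (k + 1))) (Ω ∩ frontier (sets k))
  impression_subset : ⋂ k, closure (sets k) ⊆ frontier Ω

namespace EndChain

variable {X : Type*} [PseudoMetricSpace X] {Ω : Set X}

/-- The impression of a chain. -/
def impression (E : EndChain Ω) : Set X := ⋂ k, closure (E.sets k)

/-- `E` divides `F`. -/
def Divides (E F : EndChain Ω) : Prop := ∀ k, ∃ l, E.sets l ⊆ F.sets k

theorem Divides.refl (E : EndChain Ω) : E.Divides E := fun k => ⟨k, Subset.rfl⟩

theorem Divides.trans {E F G : EndChain Ω} (h : E.Divides F) (h' : F.Divides G) :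
    E.Divides G := fun k => by
  obtain ⟨l, hl⟩ := h' k
  obtain ⟨m, hm⟩ := h l
  exact ⟨m, hm.trans hl⟩

theorem Divides.impression_subset {E F : EndChain Ω} (h : E.Divides F) :
    E.impression ⊆ F.impression := fun x hx => by
  refine mem_iInter.2 fun k => ?_
  obtain ⟨l, hl⟩ := h k
  exact closure_mono hl (mem_iInter.1 hx l)

/-- Chains are equivalent if they divide each other. -/
instance setoid (Ω : Set X) : Setoid (EndChain Ω) where
  r E F := E.Divides F ∧ F.Divides E
  iseqv :=
    { refl := fun E => ⟨Divides.refl E, Divides.refl E⟩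
      symm := fun h => ⟨h.2, h.1⟩
      trans := fun h h' => ⟨h.1.trans h'.1, h'.2.trans h.2⟩ }

/-- The sequence `E` is eventually contained in `A`. -/
def EventuallyIn (E : EndChain Ω) (A : Set X) : Prop := ∃ l, E.sets l ⊆ A

theorem EventuallyIn.of_divides {E F : EndChain Ω} {A : Set X} (h : E.Divides F)
    (hF : F.EventuallyIn A) : E.EventuallyIn A := by
  obtain ⟨k, hk⟩ := hF
  obtain ⟨l, hl⟩ := h k
  exact ⟨l, hl.trans hk⟩

/-- `E` is a `Mod_p`-chain. -/
def IsModChain [MeasurableSpace X] (μ : Measure X) (p : ℝ) (E : EndChain Ω) : Prop :=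
  ∀ K : Set X, IsCompact K → K ⊆ Ω →
    Tendsto (fun k => modulus μ p (curvesJoining (E.sets k) K Ω)) atTop (𝓝 0)

end EndChain

/-- The ends of `Ω`. -/
def DomainEnd {X : Type*} [PseudoMetricSpace X] (Ω : Set X) : Type _ :=
  Quotient (EndChain.setoid Ω)

namespace DomainEnd

variable {X : Type*} [PseudoMetricSpace X] {Ω : Set X}

/-- The end represented by a chain. -/
def mk (E : EndChain Ω) : DomainEnd Ω := Quotient.mk (EndChain.setoid Ω) E

/-- The impression of an end. -/
def impression (e : DomainEnd Ω) : Set X :=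
  Quotient.lift EndChain.impression
    (fun E F (h : E.Divides F ∧ F.Divides E) =>
      Subset.antisymm h.1.impression_subset h.2.impression_subset) e

/-- `e` divides `f`. -/
def Divides (e f : DomainEnd Ω) : Prop :=
  Quotient.lift₂ EndChain.Divides
    (fun _ _ _ _ h h' => propext
      ⟨fun H => (h.2.trans H).trans h'.1, fun H => (h.1.trans H).trans h'.2⟩) e f

/-- Some set (equivalently, all late sets) of each chain representing `e` is contained in `A`. -/
def EventuallyIn (e : DomainEnd Ω) (A : Set X) : Prop :=
  Quotient.lift (fun E : EndChain Ω => E.EventuallyIn A)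
    (fun E F (h : E.Divides F ∧ F.Divides E) => propext
      ⟨EndChain.EventuallyIn.of_divides h.2, EndChain.EventuallyIn.of_divides h.1⟩) e

/-- `e` is a prime end: no other end divides it. -/
def IsPrime (e : DomainEnd Ω) : Prop := ∀ f : DomainEnd Ω, f.Divides e → f = e

/-- `e` is a `Mod_p`-end. -/
def IsModEnd [MeasurableSpace X] (μ : Measure X) (p : ℝ) (e : DomainEnd Ω) : Prop :=
  ∃ E : EndChain Ω, E.IsModChain μ p ∧ mk E = e

/-- `e` is a `Mod_p`-prime end. -/
def IsModPrime [MeasurableSpace X] (μ : Measure X) (p : ℝ) (e : DomainEnd Ω) : Prop :=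
  e.IsModEnd μ p ∧ ∀ f : DomainEnd Ω, f.IsModEnd μ p → f.Divides e → f = e

end DomainEnd

/-! ### The topology on `Ω ∪ ∂_E Ω` -/

/-- The set `Ω ∪ ∂_E Ω`. -/
inductive EndClosure {X : Type*} [PseudoMetricSpace X] (Ω : Set X) : Type _
  | point (x : Ω) : EndClosure Ω
  | ofEnd (e : DomainEnd Ω) : EndClosure Ω

namespace EndClosure

variable {X : Type*} [PseudoMetricSpace X] {Ω : Set X}

/-- A point lies in `A`, respectively an end has a set of its chain contained in `A`. -/
def LiesIn (A : Set X) : EndClosure Ω → Prop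
  | point x => (x : X) ∈ A
  | ofEnd e => e.EventuallyIn A

/-- Convergence of sequences in `Ω ∪ ∂_E Ω`. For a sequence of points, or a sequence of ends,
tending to an end `[E_k]` this is: for each `k`, all late terms lie in `E_k`, respectively
have a set of their chain contained in `E_k`. Only points converge to points of `Ω`. -/
def ConvergesTo (y : ℕ → EndClosure Ω) : EndClosure Ω → Prop
  | point x => ∀ ε > 0, ∀ᶠ n in atTop, ∃ z : Ω, y n = point z ∧ dist z x < ε
  | ofEnd e => ∀ E : EndChain Ω, DomainEnd.mk E = e →
      ∀ k, ∀ᶠ n in atTop, (y n).LiesIn (E.sets k)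

theorem ConvergesTo.comp {y : ℕ → EndClosure Ω} {b : EndClosure Ω} (h : ConvergesTo y b)
    {φ : ℕ → ℕ} (hφ : StrictMono φ) : ConvergesTo (y ∘ φ) b := by
  cases b with
  | point x => exact fun ε hε => hφ.tendsto_atTop.eventually (h ε hε)
  | ofEnd e => exact fun E hE k => hφ.tendsto_atTop.eventually (h E hE k)

/-- `C` contains the limits of all convergent sequences in `C`. -/
def IsSeqClosedSet (C : Set (EndClosure Ω)) : Prop :=
  ∀ (y : ℕ → EndClosure Ω) (b : EndClosure Ω), (∀ n, y n ∈ C) → ConvergesTo y b → b ∈ C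

theorem IsSeqClosedSet.empty : IsSeqClosedSet (∅ : Set (EndClosure Ω)) :=
  fun _ _ h _ => (h 0).elim

theorem IsSeqClosedSet.union {C D : Set (EndClosure Ω)} (hC : IsSeqClosedSet C)
    (hD : IsSeqClosedSet D) : IsSeqClosedSet (C ∪ D) := by
  intro y b hy hb
  by_cases hf : ∃ᶠ n in atTop, y n ∈ C
  · obtain ⟨φ, hφ, hφC⟩ := extraction_of_frequently_atTop hf
    exact Or.inl (hC _ b hφC (hb.comp hφ))
  · have hf' : ∃ᶠ n in atTop, y n ∈ D := by
      rw [not_frequently] at hf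
      exact (hf.mono fun n hn => (hy n).resolve_left hn).frequently
    obtain ⟨φ, hφ, hφD⟩ := extraction_of_frequently_atTop hf'
    exact Or.inr (hD _ b hφD (hb.comp hφ))

/-- The topology whose closed sets are the sets closed under limits of sequences. -/
instance topologicalSpace : TopologicalSpace (EndClosure Ω) :=
  TopologicalSpace.ofClosed {C | IsSeqClosedSet C} IsSeqClosedSet.empty
    (fun _ hA y b hy hb => mem_sInter.2 fun C hC =>
      hA hC y b (fun n => mem_sInter.1 (hy n) C hC) hb)
    (fun _ hC _ hD => hC.union hD)

end EndClosure

/-- The prime end closure `Ω ∪ ∂_P Ω`, with the topology induced from `Ω ∪ ∂_E Ω`. -/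
abbrev PrimeEndClosure {X : Type*} [PseudoMetricSpace X] (Ω : Set X) : Type _ :=
  {y : EndClosure Ω // ∀ e : DomainEnd Ω, y = EndClosure.ofEnd e → e.IsPrime}

/-- The inclusion of `Ω` into the prime end closure. -/
def PrimeEndClosure.ofPoint {X : Type*} [PseudoMetricSpace X] {Ω : Set X} (x : Ω) :
    PrimeEndClosure Ω :=
  ⟨EndClosure.point x, fun _ h => nomatch h⟩

/-! ### The Mazurkiewicz closure -/

/-- A copy of `Ω` which is equipped with the Mazurkiewicz distance. -/
def Mazurkiewicz {X : Type*} (Ω : Set X) : Type _ := Ω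

/-- The Mazurkiewicz distance: the infimum of the diameters of the connected subsets of `Ω`
containing `x` and `y`. -/
noncomputable def mazurkiewiczDist {X : Type*} [MetricSpace X] (Ω : Set X) (x y : Ω) : ℝ≥0∞ :=
  ⨅ (E : Set X) (_ : IsConnected E ∧ E ⊆ Ω ∧ (x : X) ∈ E ∧ (y : X) ∈ E), Metric.ediam E

/-- The distance takes values in `[0, ∞]`; it is finite if `Ω` is connected and bounded. -/
noncomputable instance mazurkiewiczEMetricSpace {X : Type*} [MetricSpace X] (Ω : Set X) :
    EMetricSpace (Mazurkiewicz Ω) where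
  edist x y := mazurkiewiczDist Ω x y
  edist_self x := by
    refine le_antisymm ?_ bot_le
    refine (iInf₂_le ({(x : Ω).1} : Set X) ⟨isConnected_singleton, ?_, rfl, rfl⟩).trans ?_
    · exact Metric.ediam_singleton.le
    · exact singleton_subset_iff.2 (x : Ω).2
  edist_comm x y := by
    refine iInf_congr fun E => iInf_congr_Prop ⟨?_, ?_⟩ fun _ => rfl <;>
      exact fun h => ⟨h.1, h.2.1, h.2.2.2, h.2.2.1⟩
  edist_triangle x y z := by
    refine ENNReal.le_of_forall_pos_le_add fun ε hε hfin => ?_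
    have hε' : (ε / 2 : ℝ≥0∞) ≠ 0 := by simpa using hε.ne'
    have h1 : mazurkiewiczDist Ω x y < mazurkiewiczDist Ω x y + ε / 2 :=
      ENNReal.lt_add_right (ne_top_of_le_ne_top hfin.ne le_self_add) hε'
    have h2 : mazurkiewiczDist Ω y z < mazurkiewiczDist Ω y z + ε / 2 :=
      ENNReal.lt_add_right (ne_top_of_le_ne_top hfin.ne le_add_self) hε'
    obtain ⟨E, hE, hE'⟩ : ∃ A, ∃ _ : _, Metric.ediam A < _ := by
      simpa only [mazurkiewiczDist, iInf_lt_iff] using h1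
    obtain ⟨F, hF, hF'⟩ : ∃ A, ∃ _ : _, Metric.ediam A < _ := by
      simpa only [mazurkiewiczDist, iInf_lt_iff] using h2
    have hne : (E ∩ F).Nonempty := ⟨_, hE.2.2.2, hF.2.2.1⟩
    refine (iInf₂_le (E ∪ F) ⟨hE.1.union hne hF.1, union_subset hE.2.1 hF.2.1,
      Or.inl hE.2.2.1, Or.inr hF.2.2.2⟩).trans ?_
    refine (Metric.ediam_union_le hne).trans ((add_le_add hE'.le hF'.le).trans ?_)
    rw [add_add_add_comm, ENNReal.add_halves]
    exact le_rfl
  eq_of_edist_eq_zero {x y} h := by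
    refine Subtype.ext (edist_le_zero.1 ?_)
    rw [← h]
    exact le_iInf₂ fun E hE => Metric.edist_le_ediam_of_mem hE.2.2.1 hE.2.2.2

/-- The Mazurkiewicz closure of `Ω`: the completion of `Ω` in the Mazurkiewicz distance. -/
abbrev MazurkiewiczClosure {X : Type*} [MetricSpace X] (Ω : Set X) : Type _ :=
  UniformSpace.Completion (Mazurkiewicz Ω)

/-- The inclusion of `Ω` into the Mazurkiewicz closure. -/
noncomputable def MazurkiewiczClosure.ofPoint {X : Type*} [MetricSpace X] {Ω : Set X} (x : Ω) :
    MazurkiewiczClosure Ω :=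
  UniformSpace.Completion.coe' (show Mazurkiewicz Ω from x)

end PrimeEnds

/-!
The prime ends are the points of the Mazurkiewicz closure that lie over the boundary.

A complete doubling space is proper. The Poincaré inequality makes it locally path connected: apply
it to the infimal length of paths from `x` with jumps of size `ε`, a function with upper gradient
`1` whatever `ε` is. Telescoping over dyadic balls makes it Lipschitz with a constant independent
of `ε`, and a limit `ε → 0` turns the almost optimal paths with jumps into Lipschitz curves.

The Mazurkiewicz metric of an almost John domain is totally bounded. If the removed set `F` has
Hausdorff content less than `r`, then around every point of `Ω` some sphere of radius at most `2 r`
misses `F`, so that the point is close, in the Mazurkiewicz metric, to a point of the John domain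
`Ω \ F`. A short piece of a John curve leads from there to a point at definite distance from the
complement of `Ω`, and the set of those points is covered by finitely many small connected sets.

The Mazurkiewicz closure is therefore compact, and the sets of any chain accumulate at some point
`m` of it, which lies over a boundary point `x`. The components of `ball x r ∩ Ω` near `m` form,
for suitable `r → 0`, a chain which is a basis of the neighborhoods of `m`, and which divides every
chain accumulating at `m`. Joining points of its successive sets by paths shows that `x` is
accessible.

The sets of this chain shrink to `x`. A curve from them to a compact subset of `Ω` crosses many
dyadic annuli around `x`; a density equally distributed over `N` of these has `p`-energy at most a
constant times `N ^ (1 - p)`, which tends to `0` if `p > 1`. If `p = 1`, then the dimension set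
contains some `q > 1`, and a single annulus suffices as its radius shrinks. Hence every prime end is
a `Mod_p`-end.
-/

namespace PrimeEnds

section Doubling

variable {X : Type*} [PseudoMetricSpace X] [MeasurableSpace X] {μ : Measure X}

/-- The measure `μ` is doubling with constant `C`. -/
def IsDoublingWith (μ : Measure X) (C : ℝ≥0) : Prop :=
  ∀ (x : X) (r : ℝ), 0 < r → μ (Metric.ball x (2 * r)) ≤ C * μ (Metric.ball x r)

theorem IsDoublingWith.measure_ball_two_pow_mul_le {C : ℝ≥0} (hC : IsDoublingWith μ C)
    (x : X) {r : ℝ} (hr : 0 < r) (k : ℕ) :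
    μ (Metric.ball x (2 ^ k * r)) ≤ (C : ℝ≥0∞) ^ k * μ (Metric.ball x r) := by
  induction k with
  | zero => simp
  | succ k ih =>
    rw [pow_succ', mul_assoc, pow_succ', mul_assoc]
    exact (hC x _ (by positivity)).trans (by gcongr)

theorem totallyBounded_of_le_measure_ball [OpensMeasurableSpace X] {s : Set X}
    (hs : ∀ ε > 0, ∃ c : ℝ≥0∞, 0 < c ∧ ∀ x ∈ s, c ≤ μ (Metric.ball x ε))
    {δ : ℝ} (hδ : 0 < δ) (hfin : μ (Metric.thickening δ s) ≠ ∞) : TotallyBounded s := by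
  rw [Metric.totallyBounded_iff]
  by_contra! ⟨ε, hε, hcover⟩
  have hfar : ∀ t : Finset X, (∀ y ∈ t, y ∈ s) → ∃ y ∈ s, ∀ z ∈ t, ε ≤ dist z y := by
    intro t _
    obtain ⟨y, hy, hyt⟩ := not_subset.1 (hcover t t.finite_toSet)
    refine ⟨y, hy, fun z hz => not_lt.1 fun hzy => hyt ?_⟩
    exact mem_iUnion₂.2 ⟨z, hz, Metric.mem_ball'.2 hzy⟩
  obtain ⟨f, hfs, hf⟩ := exists_seq_of_forall_finset_exists _ _ hfar
  obtain ⟨c, hc, hcs⟩ := hs (min (ε / 2) δ) (by positivity)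
  have hdisj : Pairwise (Function.onFun Disjoint fun n => Metric.ball (f n) (min (ε / 2) δ)) := by
    refine (symm_disjoint.pairwise_on _).2 fun m n hmn => Metric.ball_disjoint_ball ?_
    linarith [hf m n hmn, min_le_left (ε / 2) δ]
  have hsub : ⋃ n, Metric.ball (f n) (min (ε / 2) δ) ⊆ Metric.thickening δ s :=
    iUnion_subset fun n => (Metric.ball_subset_ball (min_le_right _ _)).trans
      (Metric.ball_subset_thickening (hfs n) δ)
  refine infinite_univ ((Measure.finite_const_le_meas_of_disjoint_iUnion μ hc
    (fun n => Metric.isOpen_ball.measurableSet) hdisj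
    (measure_ne_top_of_subset hsub hfin)).subset fun n _ => hcs _ (hfs n))

theorem IsDoublingWith.totallyBounded_closedBall [OpensMeasurableSpace X] {C : ℝ≥0}
    (hC : IsDoublingWith μ C) (hball : BallsPosFinite μ) (x : X) (R : ℝ) :
    TotallyBounded (Metric.closedBall x R) := by
  rcases lt_or_ge R 0 with hR | hR
  · rw [Metric.closedBall_eq_empty.2 hR]
    exact totallyBounded_empty
  refine totallyBounded_of_le_measure_ball (μ := μ) (fun ε hε => ?_) one_pos ?_
  · obtain ⟨k, hk⟩ := pow_unbounded_of_one_lt ((R + ε + R) / ε) one_lt_two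
    refine ⟨μ (Metric.ball x (R + ε)) / (C : ℝ≥0∞) ^ k,
      ENNReal.div_pos (hball x _ (by positivity)).1.ne' (by simp), fun y hy => ?_⟩
    refine ENNReal.div_le_of_le_mul' ((measure_mono (Metric.ball_subset_ball' ?_)).trans
      (hC.measure_ball_two_pow_mul_le y hε k))
    linarith [(div_lt_iff₀ hε).1 hk, Metric.mem_closedBall'.1 hy]
  · refine measure_ne_top_of_subset ?_ (hball x (R + 1) (by positivity)).2.ne
    intro y hy
    obtain ⟨z, hz, hyz⟩ := Metric.mem_thickening_iff.1 hy
    rw [Metric.mem_ball]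
    linarith [dist_triangle y z x, Metric.mem_closedBall.1 hz]

theorem IsDoubling.properSpace [OpensMeasurableSpace X] [CompleteSpace X]
    (hd : IsDoubling μ) (hball : BallsPosFinite μ) : ProperSpace X := by
  obtain ⟨C, hC : IsDoublingWith μ C⟩ := hd
  exact ⟨fun x R => (hC.totallyBounded_closedBall hball x R).isCompact_of_isClosed
    Metric.isClosed_closedBall⟩

end Doubling

section MeanOscillation

theorem edist_setAverage_le {X : Type*} [MeasurableSpace X] {μ : Measure X} {A B : Set X}
    {u : X → ℝ} {c : ℝ≥0∞} (hAB : A ⊆ B) (hA : μ A ≠ 0) (hB : μ B ≠ ∞) (hc : μ B ≤ c * μ A)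
    (hu : IntegrableOn u B μ) (a : ℝ) :
    edist (⨍ y in A, u y ∂μ) a ≤ c * ⨍⁻ y in B, ‖u y - a‖ₑ ∂μ := by
  have hA' : μ A ≠ ∞ := measure_ne_top_of_subset hAB hB
  have hB' : μ B ≠ 0 := fun h => hA (measure_mono_null hAB h)
  have : IsFiniteMeasure (μ.restrict A) := ⟨by simpa using hA'.lt_top⟩
  have hsub : (⨍ y in A, u y ∂μ) - a = ⨍ y in A, (u y - a) ∂μ := by
    conv_lhs => rw [← setAverage_const hA hA' a]
    simp only [setAverage_eq]
    rw [integral_sub (hu.mono_set hAB) (integrable_const a), smul_sub]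
  have hinv : (μ A)⁻¹ ≤ c * (μ B)⁻¹ := by
    rw [← div_eq_mul_inv, ENNReal.le_div_iff_mul_le (.inl hB') (.inl hB), mul_comm,
      ← div_eq_mul_inv]
    exact ENNReal.div_le_of_le_mul hc
  calc edist (⨍ y in A, u y ∂μ) a = ‖⨍ y in A, (u y - a) ∂μ‖ₑ := by
        rw [edist_eq_enorm_sub, hsub]
    _ ≤ (μ A)⁻¹ * ∫⁻ y in A, ‖u y - a‖ₑ ∂μ := by
        refine (enorm_integral_le_lintegral_enorm _).trans_eq ?_
        rw [lintegral_smul_measure, Measure.restrict_apply_univ, smul_eq_mul]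
    _ ≤ c * (μ B)⁻¹ * ∫⁻ y in B, ‖u y - a‖ₑ ∂μ := by gcongr
    _ = c * ⨍⁻ y in B, ‖u y - a‖ₑ ∂μ := by
        rw [setLAverage_eq, ENNReal.div_eq_inv_mul, mul_assoc]

variable {X : Type*} [PseudoMetricSpace X] [MeasurableSpace X] {μ : Measure X}

theorem tendsto_setAverage_ball [OpensMeasurableSpace X] (hball : BallsPosFinite μ) {u : X → ℝ}
    {z : X} (hz : ContinuousAt u z) (hu : ∀ r, IntegrableOn u (Metric.ball z r) μ) :
    Tendsto (fun r => ⨍ y in Metric.ball z r, u y ∂μ) (𝓝[>] 0) (𝓝 (u z)) := by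
  rw [Metric.nhds_basis_closedBall.tendsto_right_iff]
  intro ε hε
  obtain ⟨δ, hδ, hδu⟩ := Metric.continuousAt_iff.1 hz ε hε
  filter_upwards [Ioo_mem_nhdsGT hδ] with r ⟨hr, hrδ⟩
  refine Convex.set_average_mem (convex_closedBall _ _) Metric.isClosed_closedBall
    (hball z r hr).1.ne' (hball z r hr).2.ne ?_ (hu r)
  filter_upwards [ae_restrict_mem Metric.isOpen_ball.measurableSet] with y hy
  exact (hδu (lt_trans hy hrδ)).le

/-- The mean oscillation of `u` over a ball is at most `K` times the radius. -/
def HasLinearMeanOscillation (μ : Measure X) (K : ℝ≥0) (u : X → ℝ) : Prop :=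
  ∀ (z : X) (r : ℝ), 0 < r →
    ⨍⁻ x in Metric.ball z r, ‖u x - ⨍ y in Metric.ball z r, u y ∂μ‖ₑ ∂μ ≤ ENNReal.ofReal (K * r)

namespace HasLinearMeanOscillation

variable {u : X → ℝ} {K C : ℝ≥0}

theorem dist_setAverage_ball_le (hK : HasLinearMeanOscillation μ K u) (hball : BallsPosFinite μ)
    (hu : ∀ z r, IntegrableOn u (Metric.ball z r) μ) {z w : X} {r s : ℝ} {c : ℝ≥0} (hr : 0 < r)
    (hs : 0 < s) (hsub : Metric.ball w s ⊆ Metric.ball z r)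
    (hc : μ (Metric.ball z r) ≤ c * μ (Metric.ball w s)) :
    dist (⨍ y in Metric.ball w s, u y ∂μ) (⨍ y in Metric.ball z r, u y ∂μ) ≤ c * (K * r) := by
  rw [dist_edist]
  refine ENNReal.toReal_le_of_le_ofReal (by positivity)
    ((edist_setAverage_le hsub (hball w s hs).1.ne' (hball z r hr).2.ne hc (hu z r) _).trans ?_)
  rw [ENNReal.ofReal_mul (by positivity), ENNReal.ofReal_coe_nnreal]
  gcongr
  exact hK z r hr

theorem dist_setAverage_ball_center_le [OpensMeasurableSpace X]
    (hK : HasLinearMeanOscillation μ K u) (hball : BallsPosFinite μ) (hC : IsDoublingWith μ C)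
    (hcont : Continuous u) (hu : ∀ z r, IntegrableOn u (Metric.ball z r) μ) (z : X) {r : ℝ}
    (hr : 0 < r) : dist (⨍ y in Metric.ball z r, u y ∂μ) (u z) ≤ 2 * C * K * r := by
  have hlim : Tendsto (fun n : ℕ => ⨍ y in Metric.ball z (r / 2 ^ n), u y ∂μ) atTop
      (𝓝 (u z)) := by
    refine (tendsto_setAverage_ball hball hcont.continuousAt (hu z)).comp
      (tendsto_nhdsWithin_iff.2 ⟨?_, Eventually.of_forall fun n => by
        rw [mem_Ioi]; positivity⟩)
    exact tendsto_const_nhds.div_atTop (tendsto_pow_atTop_atTop_of_one_lt one_lt_two)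
  have hstep : ∀ n : ℕ, dist (⨍ y in Metric.ball z (r / 2 ^ n), u y ∂μ)
      (⨍ y in Metric.ball z (r / 2 ^ (n + 1)), u y ∂μ) ≤ 2 * C * K * r / 2 / 2 ^ n := by
    intro n
    have hhalf : r / 2 ^ n = 2 * (r / 2 ^ (n + 1)) := by rw [pow_succ]; field_simp
    have hr' : 0 < r / 2 ^ (n + 1) := by positivity
    rw [dist_comm]
    refine (hK.dist_setAverage_ball_le hball hu (c := C) (by positivity) hr'
      (Metric.ball_subset_ball (by linarith)) ?_).trans_eq (by ring)
    rw [hhalf]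
    exact hC z _ hr'
  simpa using dist_le_of_le_geometric_two_of_tendsto₀ hstep hlim

theorem dist_le [OpensMeasurableSpace X] (hK : HasLinearMeanOscillation μ K u)
    (hball : BallsPosFinite μ) (hC : IsDoublingWith μ C) (hcont : Continuous u)
    (hu : ∀ z r, IntegrableOn u (Metric.ball z r) μ) (x y : X) :
    dist (u x) (u y) ≤ (6 * C * K + 2 * C ^ 2 * K) * dist x y := by
  rcases (dist_nonneg (x := x) (y := y)).eq_or_lt with h0 | hd
  · rw [((Metric.inseparable_iff.2 h0.symm).map hcont).eq, dist_self]
    positivity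
  · set d := dist x y
    have hx := hK.dist_setAverage_ball_center_le hball hC hcont hu x (r := 2 * d) (by positivity)
    have hy := hK.dist_setAverage_ball_center_le hball hC hcont hu y hd
    have hxy : dist (⨍ w in Metric.ball y d, u w ∂μ) (⨍ w in Metric.ball x (2 * d), u w ∂μ) ≤
        (C ^ 2 : ℝ≥0) * (K * (2 * d)) := by
      refine hK.dist_setAverage_ball_le hball hu (by positivity) hd
        (Metric.ball_subset_ball' (by rw [dist_comm]; linarith)) ?_
      refine (measure_mono (Metric.ball_subset_ball' (ε₂ := 2 ^ 2 * d) (by linarith))).trans ?_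
      exact (hC.measure_ball_two_pow_mul_le y hd 2).trans_eq (by push_cast; rfl)
    rw [dist_comm] at hx hxy
    push_cast at hxy
    linarith [dist_triangle4 (u x) (⨍ w in Metric.ball x (2 * d), u w ∂μ)
      (⨍ w in Metric.ball y d, u w ∂μ) (u y)]

end HasLinearMeanOscillation

end MeanOscillation

section UpperGradient

theorem lipschitzOnWith_Icc_of_dist_le {Y : Type*} [PseudoMetricSpace Y] {f : ℝ → Y} {ε : ℝ}
    (hε : 0 < ε) {a b : ℝ}
    (h : ∀ s ∈ Icc a b, ∀ t ∈ Icc a b, |s - t| ≤ ε → dist (f s) (f t) ≤ |s - t|) :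
    LipschitzOnWith 1 f (Icc a b) := by
  refine LipschitzOnWith.of_dist_le_mul fun s hs t ht => ?_
  rw [NNReal.coe_one, one_mul, Real.dist_eq]
  obtain ⟨n, hn⟩ := exists_nat_gt (|s - t| / ε)
  have hn0 : (0 : ℝ) < n := (by positivity : (0 : ℝ) ≤ |s - t| / ε).trans_lt hn
  have hmesh : |s - t| / n ≤ ε := by
    rw [div_le_iff₀ hn0, mul_comm]
    exact ((div_lt_iff₀ hε).1 hn).le
  let c : ℕ → ℝ := fun k => AffineMap.lineMap s t ((k : ℝ) / n)
  have hcmem : ∀ k ≤ n, c k ∈ Icc a b := fun k hk =>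
    (convex_Icc a b).lineMap_mem hs ht
      ⟨by positivity, (div_le_one hn0).2 (by exact_mod_cast hk)⟩
  have hcstep : ∀ k, |c k - c (k + 1)| = |s - t| / n := by
    intro k
    rw [← Real.dist_eq, dist_lineMap_lineMap, Real.dist_eq, Real.dist_eq, Nat.cast_succ,
      ← sub_div, sub_add_cancel_left, abs_div, abs_neg, abs_one, Nat.abs_cast]
    ring
  have hsum := dist_le_range_sum_of_dist_le (f := fun k => f (c k)) n
    (d := fun _ => |s - t| / n) fun {k} hk => by
      rw [← hcstep k]
      exact h _ (hcmem k hk.le) _ (hcmem (k + 1) hk) ((hcstep k).trans_le hmesh)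
  simpa [c, hn0.ne', mul_div_cancel₀] using hsum

variable {X : Type*} [PseudoMetricSpace X]

theorem lipschitzOnWith_one_of_hasUnitSpeedOn {γ : ℝ → X} {s : Set ℝ} (h : HasUnitSpeedOn γ s) :
    LipschitzOnWith 1 γ s := by
  refine LipschitzOnWith.of_dist_le_mul fun a ha b hb => ?_
  rw [NNReal.coe_one, one_mul]
  wlog hab : a ≤ b generalizing a b
  · rw [dist_comm, dist_comm a]
    exact this b hb a ha (le_of_not_ge hab)
  have hvar := eVariationOn.edist_le γ (s := s ∩ Icc a b) ⟨ha, le_rfl, hab⟩ ⟨hb, hab, le_rfl⟩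
  rw [h ha hb, NNReal.coe_one, one_mul, edist_le_ofReal (sub_nonneg.2 hab)] at hvar
  rwa [dist_comm a b, Real.dist_eq, abs_of_nonneg (sub_nonneg.2 hab)]

theorem isUpperGradient_indicator [MeasurableSpace X] {v : X → ℝ} {U : Set X}
    (hU : MeasurableSet U) {ε : ℝ} (hε : 0 < ε) (hv0 : ∀ y, 0 ≤ v y) (hvU : ∀ y ∉ U, v y = 0)
    (hloc : ∀ y z, dist y z ≤ ε → dist (v y) (v z) ≤ dist y z) :
    IsUpperGradient (U.indicator 1) v := by
  refine ⟨measurable_one.indicator hU, fun γ => ?_⟩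
  set f : ℝ → ℝ := fun t => v (γ.toFun t) with hf
  have hγ := lipschitzOnWith_one_of_hasUnitSpeedOn γ.unitSpeed
  have hlip : LipschitzOnWith 1 f (Icc 0 γ.len) := by
    refine lipschitzOnWith_Icc_of_dist_le hε fun s hs t ht hst => ?_
    have hst' : dist (γ.toFun s) (γ.toFun t) ≤ |s - t| := by
      simpa [Real.dist_eq] using hγ.dist_le_mul s hs t ht
    exact (hloc _ _ (hst'.trans hst)).trans hst'
  have hderiv : ∀ t ∈ Ioo 0 γ.len, ‖deriv f t‖ₑ ≤ U.indicator 1 (γ.toFun t) := by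
    intro t ht
    by_cases hmem : γ.toFun t ∈ U
    · rw [indicator_of_mem hmem, Pi.one_apply, ← ofReal_norm, ENNReal.ofReal_le_one]
      simpa using norm_deriv_le_of_lipschitzOn (Icc_mem_nhds ht.1 ht.2) hlip
    · have hmin : IsLocalMin f t := Eventually.of_forall fun s => by
        simpa only [hf, hvU _ hmem] using hv0 _
      rw [hmin.deriv_eq_zero, enorm_zero]
      exact bot_le
  have hFTC : ∫ t in 0..γ.len, deriv f t = f γ.len - f 0 :=
    (LipschitzOnWith.absolutelyContinuousOnInterval
      (by rwa [uIcc_of_le γ.len_pos.le])).integral_deriv_eq_sub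
  calc ENNReal.ofReal |v (γ.toFun 0) - v (γ.toFun γ.len)|
      = ‖∫ t in Ioo 0 γ.len, deriv f t‖ₑ := by
        rw [← integral_Ioc_eq_integral_Ioo, ← intervalIntegral.integral_of_le γ.len_pos.le, hFTC,
          enorm_sub_rev, ← Real.enorm_eq_ofReal_abs]
    _ ≤ ∫⁻ t in Ioo 0 γ.len, ‖deriv f t‖ₑ := enorm_integral_le_lintegral_enorm _
    _ ≤ ∫⁻ t in Ioo 0 γ.len, U.indicator 1 (γ.toFun t) :=
      setLIntegral_mono' measurableSet_Ioo hderiv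
    _ ≤ lineIntegral (U.indicator 1) γ := lintegral_mono_set Ioo_subset_Icc_self

end UpperGradient

section Poincare

theorem lintegral_enorm_rpow_lt_top_of_eq_zero {X : Type*} [MeasurableSpace X] {μ : Measure X}
    {U : Set X} (hU : MeasurableSet U) (hfin : μ U < ∞) {v : X → ℝ} (hvU : ∀ y ∉ U, v y = 0)
    {T : ℝ} (hT : ∀ y, ‖v y‖ ≤ T) {p : ℝ} (hp : 0 < p) :
    ∫⁻ x, ‖v x‖ₑ ^ p ∂μ < ∞ := by
  calc ∫⁻ x, ‖v x‖ₑ ^ p ∂μ ≤ ∫⁻ x, U.indicator (fun _ => ENNReal.ofReal T ^ p) x ∂μ := by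
        refine lintegral_mono fun x => ?_
        by_cases hx : x ∈ U
        · rw [indicator_of_mem hx, ← ofReal_norm]
          gcongr
          exact hT x
        · simp [hvU x hx, hp]
    _ = ENNReal.ofReal T ^ p * μ U := lintegral_indicator_const hU _
    _ < ∞ := ENNReal.mul_lt_top (ENNReal.rpow_lt_top_of_nonneg hp.le ENNReal.ofReal_ne_top) hfin

variable {X : Type*} [PseudoMetricSpace X] [MeasurableSpace X] {μ : Measure X}

theorem BallsPosFinite.measure_ball_lt_top (hball : BallsPosFinite μ) (x : X) (r : ℝ) :
    μ (Metric.ball x r) < ∞ := by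
  rcases le_or_gt r 0 with hr | hr
  · simp [Metric.ball_eq_empty.2 hr]
  · exact (hball x r hr).2

theorem BallsPosFinite.integrableOn_ball [OpensMeasurableSpace X] (hball : BallsPosFinite μ)
    {v : X → ℝ} (hv : Continuous v) {T : ℝ} (hT : ∀ y, ‖v y‖ ≤ T) (z : X) (r : ℝ) :
    IntegrableOn v (Metric.ball z r) μ :=
  Measure.integrableOn_of_bounded (hball.measure_ball_lt_top z r).ne hv.aestronglyMeasurable
    (Eventually.of_forall hT)

theorem SupportsPoincare.exists_hasLinearMeanOscillation [BorelSpace X] {p : ℝ} (hp : 0 < p)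
    (hball : BallsPosFinite μ) (hpoinc : SupportsPoincare μ p) :
    ∃ K : ℝ≥0, ∀ (v : X → ℝ) (x : X) (R T ε : ℝ), 0 < ε → Continuous v →
      (∀ y, v y ∈ Icc 0 T) → (∀ y ∉ Metric.ball x R, v y = 0) →
      (∀ y z, dist y z ≤ ε → dist (v y) (v z) ≤ dist y z) → HasLinearMeanOscillation μ K v := by
  obtain ⟨C, L, -, hC⟩ := hpoinc
  refine ⟨2 * C, fun v x R T ε hε hcont hvT hvR hloc z r hr => ?_⟩
  set g : X → ℝ≥0∞ := (Metric.ball x R).indicator 1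
  have hg : ∀ y, g y ^ p = g y := by
    intro y
    by_cases hy : y ∈ Metric.ball x R <;> simp [g, hy, hp]
  have hvp : ∫⁻ y, ‖v y‖ₑ ^ p ∂μ < ∞ :=
    lintegral_enorm_rpow_lt_top_of_eq_zero Metric.isOpen_ball.measurableSet
      (hball.measure_ball_lt_top x R) hvR
      (fun y => (Real.norm_of_nonneg (hvT y).1).trans_le (hvT y).2) hp
  have hgp : ∫⁻ y, g y ^ p ∂μ < ∞ := by
    simp_rw [hg]
    exact (lintegral_indicator_one Metric.isOpen_ball.measurableSet).trans_lt
      (hball.measure_ball_lt_top x R)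
  have hgrad : IsUpperGradient g v :=
    isUpperGradient_indicator Metric.isOpen_ball.measurableSet hε (fun y => (hvT y).1) hvR hloc
  have havg : (⨍⁻ y in Metric.ball z (L * r), g y ^ p ∂μ) ^ (1 / p) ≤ 1 := by
    simp_rw [hg]
    refine ENNReal.rpow_le_one ?_ (by positivity)
    rw [setLAverage_eq]
    refine ENNReal.div_le_of_le_mul ?_
    rw [one_mul, ← setLIntegral_one]
    exact lintegral_mono fun y => indicator_le_self' (fun _ _ => bot_le) y
  have hdiam : Metric.ediam (Metric.ball z r) ≤ 2 * ENNReal.ofReal r := by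
    rw [← Metric.eball_ofReal]
    exact Metric.ediam_eball_le
  calc _ ≤ C * Metric.ediam (Metric.ball z r) *
        (⨍⁻ y in Metric.ball z (L * r), g y ^ p ∂μ) ^ (1 / p) :=
        hC v g hcont.measurable.aemeasurable hvp hgrad hgp z r hr
    _ ≤ C * (2 * ENNReal.ofReal r) * 1 := by gcongr
    _ = ENNReal.ofReal ((2 * C : ℝ≥0) * r) := by
      rw [mul_one, ENNReal.ofReal_mul (by positivity), ENNReal.ofReal_coe_nnreal]
      push_cast
      ring

theorem SupportsPoincare.exists_dist_le [BorelSpace X] {p : ℝ} (hp : 0 < p)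
    (hball : BallsPosFinite μ) (hd : IsDoubling μ) (hpoinc : SupportsPoincare μ p) :
    ∃ K : ℝ, 0 ≤ K ∧ ∀ (v : X → ℝ) (x : X) (R T ε : ℝ), 0 < ε →
      (∀ y, v y ∈ Icc 0 T) → (∀ y ∉ Metric.ball x R, v y = 0) →
      (∀ y z, dist y z ≤ ε → dist (v y) (v z) ≤ dist y z) →
      ∀ y z, dist (v y) (v z) ≤ K * dist y z := by
  obtain ⟨C, hC⟩ := hd
  obtain ⟨K, hK⟩ := hpoinc.exists_hasLinearMeanOscillation hp hball
  refine ⟨6 * C * K + 2 * C ^ 2 * K, by positivity, fun v x R T ε hε hvT hvR hloc => ?_⟩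
  have hcont : Continuous v := by
    refine Metric.continuous_iff.2 fun z δ hδ => ⟨min ε δ, lt_min hε hδ, fun w hw => ?_⟩
    exact (hloc w z (hw.le.trans (min_le_left _ _))).trans_lt (hw.trans_le (min_le_right _ _))
  exact (hK v x R T ε hε hcont hvT hvR hloc).dist_le hball hC hcont (hball.integrableOn_ball hcont
    fun y => (Real.norm_of_nonneg (hvT y).1).trans_le (hvT y).2)

end Poincare

section ApproxPath

/-- `f` is a curve from `x` to `y` of length `l` and unit speed, up to jumps of size `ε`. It is
defined on `ℝ`, is equal to `y` from time `l` on, and need not be continuous. -/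
structure IsApproxPath {X : Type*} [PseudoMetricSpace X] (ε : ℝ) (x y : X) (l : ℝ) (f : ℝ → X) :
    Prop where
  nonneg : 0 ≤ l
  source : f 0 = x
  target : ∀ t, l ≤ t → f t = y
  dist_le : ∀ s t, dist (f s) (f t) ≤ |s - t| + ε

/-- The infimal length of `ε`-approximate paths from `x` to `y`, truncated at `T`. -/
noncomputable def approxDist {X : Type*} [PseudoMetricSpace X] (ε T : ℝ) (x y : X) : ℝ :=
  sInf ({l | ∃ f, IsApproxPath ε x y l f} ∪ {T})

section Pseudo

variable {X : Type*} [PseudoMetricSpace X] {ε T : ℝ} {x y : X}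

theorem isApproxPath_const (hε : 0 ≤ ε) (x : X) : IsApproxPath ε x x 0 fun _ => x :=
  ⟨le_rfl, rfl, fun _ _ => rfl, fun s t => by rw [dist_self]; positivity⟩

theorem nonneg_of_mem_approxDist (hT : 0 ≤ T) {l : ℝ}
    (hl : l ∈ {l | ∃ f, IsApproxPath ε x y l f} ∪ {T}) : 0 ≤ l := by
  rcases hl with ⟨f, hf⟩ | rfl
  exacts [hf.nonneg, hT]

theorem approxDist_le_of_mem (hT : 0 ≤ T) {l : ℝ}
    (hl : l ∈ {l | ∃ f, IsApproxPath ε x y l f} ∪ {T}) : approxDist ε T x y ≤ l :=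
  csInf_le ⟨0, fun _ => nonneg_of_mem_approxDist hT⟩ hl

theorem approxDist_nonneg (hT : 0 ≤ T) (x y : X) : 0 ≤ approxDist ε T x y :=
  le_csInf ⟨T, Or.inr rfl⟩ fun _ => nonneg_of_mem_approxDist hT

theorem approxDist_le (hT : 0 ≤ T) (x y : X) : approxDist ε T x y ≤ T :=
  approxDist_le_of_mem hT (Or.inr rfl)

theorem approxDist_self (hε : 0 ≤ ε) (hT : 0 ≤ T) (x : X) : approxDist ε T x x = 0 :=
  le_antisymm (approxDist_le_of_mem hT (Or.inl ⟨_, isApproxPath_const hε x⟩))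
    (approxDist_nonneg hT x x)

theorem exists_isApproxPath_of_approxDist_lt (h : approxDist ε T x y < T) :
    ∃ f, IsApproxPath ε x y T f := by
  obtain ⟨l, ⟨f, hf⟩ | rfl, hlT⟩ := exists_lt_of_csInf_lt ⟨T, Or.inr rfl⟩ h
  · exact ⟨f, hf.nonneg.trans hlT.le, hf.source, fun t ht => hf.target t (hlT.le.trans ht),
      hf.dist_le⟩
  · exact absurd hlT (lt_irrefl _)

end Pseudo

variable {X : Type*} [MetricSpace X] {ε T : ℝ}

theorem IsApproxPath.exists_extend {l : ℝ} {x y z : X} {f : ℝ → X}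
    (h : IsApproxPath ε x y l f) (hyz : dist y z ≤ ε) :
    ∃ g, IsApproxPath ε x z (l + dist y z) g := by
  have hε : 0 ≤ ε := dist_nonneg.trans hyz
  have hl := h.nonneg
  have hjump : ∀ s t, s < l + dist y z → l + dist y z ≤ t → dist (f s) z ≤ |s - t| + ε := by
    intro s t hs ht
    rw [abs_sub_comm, abs_of_nonneg (by linarith)]
    rcases le_or_gt l s with hls | hls
    · rw [h.target s hls]
      linarith
    · have hfs := h.dist_le s l
      rw [h.target l le_rfl, abs_sub_comm, abs_of_pos (sub_pos.2 hls)] at hfs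
      linarith [dist_triangle (f s) y z]
  refine ⟨fun t => if t < l + dist y z then f t else z, by positivity, ?_, ?_, ?_⟩
  · split_ifs with hpos
    · exact h.source
    · have hyz0 : dist y z = 0 := by linarith [dist_nonneg (x := y) (y := z)]
      rw [← dist_eq_zero.1 hyz0, ← h.target 0 (by linarith), h.source]
  · exact fun t ht => if_neg (not_lt.2 ht)
  · intro s t
    split_ifs with hs ht ht
    · exact h.dist_le s t
    · exact hjump s t hs (not_lt.1 ht)
    · rw [dist_comm, abs_sub_comm]
      exact hjump t s ht (not_lt.1 hs)
    · rw [dist_self]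
      positivity

theorem approxDist_le_add (hT : 0 ≤ T) (x : X) {y z : X} (h : dist y z ≤ ε) :
    approxDist ε T x z ≤ approxDist ε T x y + dist y z := by
  rw [← sub_le_iff_le_add]
  refine le_csInf ⟨T, Or.inr rfl⟩ ?_
  rintro l (⟨f, hf⟩ | rfl) <;> rw [sub_le_iff_le_add]
  · exact approxDist_le_of_mem hT (Or.inl (hf.exists_extend h))
  · exact (approxDist_le hT x z).trans (le_add_of_nonneg_right dist_nonneg)

/-- The approximate distance from `x`, cut off outside the ball of radius `R` around `x`. The
Poincaré inequality is applied to this function. -/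
noncomputable def approxPotential (ε T R : ℝ) (x z : X) : ℝ :=
  min (approxDist ε T x z) (max 0 (R - dist z x))

theorem approxPotential_mem_Icc (hT : 0 ≤ T) (R : ℝ) (x z : X) :
    approxPotential ε T R x z ∈ Icc 0 T :=
  ⟨le_min (approxDist_nonneg hT x z) (le_max_left _ _),
    (min_le_left _ _).trans (approxDist_le hT x z)⟩

theorem approxPotential_self (hε : 0 ≤ ε) (hT : 0 ≤ T) (R : ℝ) (x : X) :
    approxPotential ε T R x x = 0 := by
  rw [approxPotential, approxDist_self hε hT]
  exact min_eq_left (le_max_left _ _)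

theorem approxPotential_eq_zero (hT : 0 ≤ T) {R : ℝ} {x z : X} (hz : z ∉ Metric.ball x R) :
    approxPotential ε T R x z = 0 := by
  rw [Metric.mem_ball, not_lt] at hz
  rw [approxPotential, max_eq_left (sub_nonpos.2 hz)]
  exact min_eq_right (approxDist_nonneg hT x z)

theorem dist_approxPotential_le (hT : 0 ≤ T) (R : ℝ) (x : X) {y z : X} (h : dist y z ≤ ε) :
    dist (approxPotential ε T R x y) (approxPotential ε T R x z) ≤ dist y z := by
  have hle : ∀ y z : X, dist y z ≤ ε →
      approxPotential ε T R x y ≤ approxPotential ε T R x z + dist y z := by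
    intro y z hyz
    rw [approxPotential, approxPotential, ← min_add_add_right, ← max_add_add_right]
    refine min_le_min ?_ (max_le_max (by positivity) ?_)
    · rw [dist_comm] at hyz ⊢
      exact approxDist_le_add hT x hyz
    · linarith [dist_triangle_left z x y]
  rw [Real.dist_eq, abs_sub_le_iff, sub_le_iff_le_add', sub_le_iff_le_add']
  refine ⟨hle y z h, ?_⟩
  rw [dist_comm y z] at h ⊢
  exact hle z y h

theorem exists_path_of_isApproxPath [ProperSpace X] {x y : X}
    (h : ∀ ε > 0, ∃ f, IsApproxPath ε x y T f) :
    ∃ f : ℝ → X, f 0 = x ∧ f T = y ∧ LipschitzWith 1 f := by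
  choose f hf using fun n : ℕ => h (1 / ((n : ℝ) + 1)) Nat.one_div_pos_of_nat
  have hlim : ∀ t, ∃ z, Tendsto (fun n => f n t) (hyperfilter ℕ) (𝓝 z) := by
    intro t
    have hmem : ∀ n, f n t ∈ Metric.closedBall x (|t| + 1) := by
      intro n
      have hdist := (hf n).dist_le t 0
      rw [(hf n).source, sub_zero] at hdist
      have hn : 1 / ((n : ℝ) + 1) ≤ 1 :=
        (div_le_one (by positivity)).2 (le_add_of_nonneg_left n.cast_nonneg)
      exact hdist.trans (by linarith)
    obtain ⟨z, -, hz⟩ := (isCompact_closedBall x (|t| + 1)).ultrafilter_le_nhds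
      ((hyperfilter ℕ).map fun n => f n t)
      (le_principal_iff.2 (Ultrafilter.mem_map.2 (Eventually.of_forall hmem)))
    exact ⟨z, hz⟩
  choose F hF using hlim
  have hconst : ∀ {t z}, (∀ n, f n t = z) → F t = z := fun {t z} hz =>
    tendsto_nhds_unique (hF t) (by simpa only [hz] using tendsto_const_nhds)
  refine ⟨F, hconst fun n => (hf n).source, hconst fun n => (hf n).target T le_rfl,
    LipschitzWith.mk_one fun s t => ?_⟩
  have hjump : Tendsto (fun n : ℕ => |s - t| + 1 / ((n : ℝ) + 1)) (hyperfilter ℕ)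
      (𝓝 (|s - t| + 0)) :=
    (tendsto_one_div_add_atTop_nhds_zero_nat.mono_left
      (hyperfilter_le_cofinite.trans Nat.cofinite_eq_atTop.le)).const_add _
  rw [add_zero] at hjump
  exact le_of_tendsto_of_tendsto' ((hF s).dist (hF t)) hjump fun n => (hf n).dist_le s t

end ApproxPath

section Quasiconvex

variable {X : Type*} [MetricSpace X] [MeasurableSpace X] [BorelSpace X]
  {μ : Measure X} {p : ℝ}

theorem SupportsPoincare.exists_isApproxPath (hp : 0 < p) (hball : BallsPosFinite μ)
    (hd : IsDoubling μ) (hpoinc : SupportsPoincare μ p) :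
    ∃ K : ℝ, 1 ≤ K ∧ ∀ (x y : X), ∀ ε > 0, ∃ f, IsApproxPath ε x y (K * dist x y) f := by
  obtain ⟨K, hK0, hK⟩ := hpoinc.exists_dist_le hp hball hd
  refine ⟨K + 1, by linarith, fun x y ε hε => ?_⟩
  rcases eq_or_ne x y with rfl | hxy
  · rw [dist_self, mul_zero]
    exact ⟨_, isApproxPath_const hε.le x⟩
  have hdist := dist_pos.2 hxy
  set T := (K + 1) * dist x y
  have hT0 : 0 ≤ T := by positivity
  set R := T + dist x y with hR
  have hlip := hK (approxPotential ε T R x) x R T ε hε (approxPotential_mem_Icc hT0 R x)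
    (fun z hz => approxPotential_eq_zero hT0 hz) (fun z w => dist_approxPotential_le hT0 R x) x y
  rw [approxPotential_self hε.le hT0, Real.dist_eq, zero_sub, abs_neg,
    abs_of_nonneg (approxPotential_mem_Icc hT0 R x y).1] at hlip
  refine exists_isApproxPath_of_approxDist_lt (not_le.1 fun hle => ?_)
  have hTy : T ≤ approxPotential ε T R x y :=
    le_min hle (le_max_of_le_right (by rw [dist_comm y x, hR]; linarith))
  linarith

variable [CompleteSpace X]

theorem SupportsPoincare.exists_lipschitz_path (hp : 0 < p) (hball : BallsPosFinite μ)
    (hd : IsDoubling μ) (hpoinc : SupportsPoincare μ p) :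
    ∃ K : ℝ, 1 ≤ K ∧ ∀ x y : X, ∃ f : ℝ → X,
      f 0 = x ∧ f (K * dist x y) = y ∧ LipschitzWith 1 f := by
  have := hd.properSpace hball
  obtain ⟨K, hK1, hK⟩ := hpoinc.exists_isApproxPath hp hball hd
  exact ⟨K, hK1, fun x y => exists_path_of_isApproxPath fun ε hε => hK x y ε hε⟩

theorem SupportsPoincare.exists_joinedIn_ball (hp : 0 < p) (hball : BallsPosFinite μ)
    (hd : IsDoubling μ) (hpoinc : SupportsPoincare μ p) :
    ∃ K : ℝ, 1 ≤ K ∧ ∀ (x y : X) (r : ℝ), K * dist x y < r →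
      JoinedIn (Metric.ball x r) x y := by
  obtain ⟨K, hK1, hK⟩ := hpoinc.exists_lipschitz_path hp hball hd
  refine ⟨K, hK1, fun x y r hr => ?_⟩
  obtain ⟨f, hf0, hf1, hf⟩ := hK x y
  have hlen : 0 ≤ K * dist x y := by positivity
  refine JoinedIn.ofLine (f := fun t => f (t * (K * dist x y))) ?_ ?_ ?_ ?_
  · exact (hf.continuous.comp (continuous_mul_const _)).continuousOn
  · simpa using hf0
  · simpa using hf1
  · rintro _ ⟨t, ht, rfl⟩
    have hdist := hf.dist_le_mul (t * (K * dist x y)) 0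
    rw [hf0, dist_zero_right, NNReal.coe_one, one_mul,
      Real.norm_of_nonneg (mul_nonneg ht.1 hlen)] at hdist
    exact (hdist.trans (mul_le_of_le_one_left hlen ht.2)).trans_lt hr

theorem SupportsPoincare.locallyPathConnectedSpace (hp : 0 < p) (hball : BallsPosFinite μ)
    (hd : IsDoubling μ) (hpoinc : SupportsPoincare μ p) : LocallyPathConnectedSpace X := by
  obtain ⟨K, hK1, hK⟩ := hpoinc.exists_joinedIn_ball hp hball hd
  have hK0 : 0 < K := one_pos.trans_le hK1
  rw [locallyPathConnectedSpace_iff_pathComponentIn_mem_nhds]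
  intro x u hu hxu
  obtain ⟨r, hr, hru⟩ := Metric.isOpen_iff.1 hu x hxu
  refine mem_of_superset (Metric.ball_mem_nhds x (div_pos hr hK0)) fun y hy => ?_
  refine (hK x y r ?_).mono hru
  rwa [Metric.mem_ball', lt_div_iff₀ hK0, mul_comm] at hy

end Quasiconvex

section TotallyBounded

theorem exists_sphere_disjoint {X : Type*} [PseudoMetricSpace X] {F : Set X} {r : ℝ}
    (hF : hausdorffContent 1 F < ENNReal.ofReal r) (x : X) :
    ∃ s ∈ Ioo 0 (2 * r), Disjoint F (Metric.sphere x s) := by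
  simp only [hausdorffContent, iInf_lt_iff, ENNReal.rpow_one] at hF
  obtain ⟨c, ρ, -, hcov, hsum⟩ := hF
  by_contra! hmeet
  have hsub : Ioo 0 (2 * r) ⊆ ⋃ j, Ioo (dist (c j) x - ρ j) (dist (c j) x + ρ j) := by
    intro s hs
    obtain ⟨y, hy, rfl⟩ := not_disjoint_iff.1 (hmeet s hs)
    obtain ⟨j, hj⟩ := mem_iUnion.1 (hcov hy)
    rw [Metric.mem_ball] at hj
    refine mem_iUnion.2 ⟨j, ?_, ?_⟩
    · linarith [dist_triangle_left (c j) x y]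
    · linarith [dist_triangle y (c j) x]
  have hlen : ∀ j, ENNReal.ofReal (dist (c j) x + ρ j - (dist (c j) x - ρ j)) =
      2 * ENNReal.ofReal (ρ j) := by
    intro j
    rw [show dist (c j) x + ρ j - (dist (c j) x - ρ j) = 2 * ρ j by ring,
      ENNReal.ofReal_mul zero_le_two, ENNReal.ofReal_ofNat]
  have hle := (measure_mono hsub).trans (measure_iUnion_le (μ := volume) _)
  simp only [Real.volume_Ioo, sub_zero, hlen, ENNReal.tsum_mul_left,
    ENNReal.ofReal_mul zero_le_two, ENNReal.ofReal_ofNat] at hle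
  exact hsum.not_ge ((ENNReal.mul_le_mul_iff_right two_ne_zero ENNReal.ofNat_ne_top).1 hle)

theorem exists_isConnected_inter_sphere_nonempty {X : Type*} [PseudoMetricSpace X] {Ω : Set X}
    {x y : X} (hxy : JoinedIn Ω x y) {s : ℝ} (hs : 0 ≤ s) (hsy : s ≤ dist y x) :
    ∃ A ⊆ Ω, IsConnected A ∧ x ∈ A ∧ A ⊆ Metric.closedBall x s ∧
      (A ∩ Metric.sphere x s).Nonempty := by
  obtain ⟨γ, hγ⟩ := hxy
  have hdist : Continuous fun t => dist (γ t) x := γ.continuous.dist continuous_const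
  have hexit : IsCompact {t | s ≤ dist (γ t) x} := (isClosed_le continuous_const hdist).isCompact
  obtain ⟨t₁, ht₁, hmin⟩ := hexit.exists_isLeast ⟨1, by simpa using hsy⟩
  obtain ⟨t, ht, hts⟩ := intermediate_value_Icc (a := 0) (b := t₁) bot_le hdist.continuousOn
    (show s ∈ Icc _ _ from ⟨by simpa using hs, ht₁⟩)
  obtain rfl : t = t₁ := le_antisymm ht.2 (hmin hts.ge)
  refine ⟨γ '' Icc 0 t, image_subset_iff.2 fun u _ => hγ u,
    (isConnected_Icc bot_le).image _ γ.continuous.continuousOn, ⟨0, ⟨le_rfl, bot_le⟩, γ.source⟩,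
    image_subset_iff.2 fun u hu => ?_, γ t, ⟨t, ⟨bot_le, le_rfl⟩, rfl⟩, hts⟩
  rcases hu.2.eq_or_lt with rfl | hlt
  · exact hts.le
  · exact (not_le.1 fun h : s ≤ dist (γ u) x => hlt.not_ge (hmin h)).le

variable {X : Type*} [MetricSpace X] {Ω : Set X}

theorem mazurkiewiczDist_le_ediam {A : Set X} (hA : IsConnected A) (hAΩ : A ⊆ Ω) {x y : Ω}
    (hx : (x : X) ∈ A) (hy : (y : X) ∈ A) : mazurkiewiczDist Ω x y ≤ Metric.ediam A :=
  iInf₂_le A ⟨hA, hAΩ, hx, hy⟩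

theorem mazurkiewiczDist_le_of_subset_closedBall {A : Set X} (hA : IsConnected A) (hAΩ : A ⊆ Ω)
    {x y : Ω} (hx : (x : X) ∈ A) (hy : (y : X) ∈ A) {z : X} {r : ℝ}
    (hr : A ⊆ Metric.closedBall z r) : mazurkiewiczDist Ω x y ≤ ENNReal.ofReal (2 * r) := by
  refine (mazurkiewiczDist_le_ediam hA hAΩ hx hy).trans (Metric.ediam_le fun a ha b hb => ?_)
  rw [edist_dist]
  refine ENNReal.ofReal_le_ofReal ?_
  linarith [dist_triangle_right a b z, Metric.mem_closedBall.1 (hr ha),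
    Metric.mem_closedBall.1 (hr hb)]

theorem exists_notMem_mazurkiewiczDist_le (hΩ : IsPathConnected Ω) {F : Set X} {r : ℝ}
    (hF : hausdorffContent 1 F < ENNReal.ofReal r) (hne : (Ω \ F).Nonempty) (x : Ω) :
    ∃ y : Ω, (y : X) ∉ F ∧ mazurkiewiczDist Ω x y ≤ ENNReal.ofReal (4 * r) := by
  obtain ⟨s, hs, hsF⟩ := exists_sphere_disjoint hF (x : X)
  have hle : ENNReal.ofReal (2 * s) ≤ ENNReal.ofReal (4 * r) :=
    ENNReal.ofReal_le_ofReal (by linarith [hs.2])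
  by_cases hball : Ω ⊆ Metric.closedBall x s
  · obtain ⟨w, hw, hwF⟩ := hne
    exact ⟨⟨w, hw⟩, hwF, (mazurkiewiczDist_le_of_subset_closedBall hΩ.isConnected Subset.rfl x.2
      hw hball).trans hle⟩
  · obtain ⟨w, hw, hws⟩ := not_subset.1 hball
    rw [Metric.mem_closedBall, not_le] at hws
    obtain ⟨A, hAΩ, hA, hxA, hAs, y, hyA, hys⟩ :=
      exists_isConnected_inter_sphere_nonempty (hΩ.joinedIn x x.2 w hw) hs.1.le hws.le
    exact ⟨⟨y, hAΩ hyA⟩, disjoint_right.1 hsF hys,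
      (mazurkiewiczDist_le_of_subset_closedBall hA hAΩ hxA hyA hAs).trans hle⟩

theorem mazurkiewiczDist_le_of_hasUnitSpeedOn {γ : ℝ → X} {l b : ℝ}
    (hγ : HasUnitSpeedOn γ (Icc 0 l)) (hγΩ : ∀ t ∈ Icc 0 l, γ t ∈ Ω) (hb : b ∈ Icc 0 l) {y : Ω}
    (hy : γ 0 = y) : mazurkiewiczDist Ω y ⟨γ b, hγΩ b hb⟩ ≤ ENNReal.ofReal (2 * b) := by
  have hlip := lipschitzOnWith_one_of_hasUnitSpeedOn hγ
  have hsub : Icc 0 b ⊆ Icc 0 l := Icc_subset_Icc le_rfl hb.2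
  refine mazurkiewiczDist_le_of_subset_closedBall (z := y) (A := γ '' Icc 0 b)
    ((isConnected_Icc hb.1).image _ (hlip.continuousOn.mono hsub))
    (image_subset_iff.2 fun t ht => hγΩ t (hsub ht)) ⟨0, ⟨le_rfl, hb.1⟩, hy⟩
    ⟨b, ⟨hb.1, le_rfl⟩, rfl⟩ (image_subset_iff.2 fun t ht => ?_)
  have hdist := hlip.dist_le_mul t (hsub ht) 0 ⟨le_rfl, hb.1.trans hb.2⟩
  rw [hy, NNReal.coe_one, one_mul, Real.dist_0_eq_abs, abs_of_nonneg ht.1] at hdist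
  exact hdist.trans ht.2

theorem IsJohnDomain.exists_mazurkiewiczDist_le {F : Set X} (hΩ : IsOpen Ω)
    (huniv : Ω ≠ univ) (hJ : IsJohnDomain (Ω \ F)) {δ : ℝ} (hδ : 0 < δ) :
    ∃ η > 0, ∀ y : Ω, (y : X) ∉ F →
      ∃ z : Ω, η ≤ Metric.infDist (z : X) Ωᶜ ∧ mazurkiewiczDist Ω y z ≤ ENNReal.ofReal (2 * δ) := by
  obtain ⟨-, C, hC, x₀, hx₀, hJ⟩ := hJ
  have hne : (Ωᶜ).Nonempty := nonempty_compl.2 huniv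
  have hC0 : 0 < C := one_pos.trans_le hC
  refine ⟨min (δ / C) (Metric.infDist x₀ Ωᶜ), lt_min (by positivity)
    ((hΩ.isClosed_compl.notMem_iff_infDist_pos hne).1 fun h => h hx₀.1), fun y hy => ?_⟩
  obtain ⟨l, γ, hl, hγ, h0, h1, hγC⟩ := hJ y ⟨y.2, hy⟩
  have hγΩ : ∀ t ∈ Icc 0 l, γ t ∈ Ω := fun t ht => (hγC t ht).1.1
  rcases le_or_gt l δ with hlδ | hlδ
  · exact ⟨⟨γ l, h1 ▸ hx₀.1⟩, by simp [h1],
      (mazurkiewiczDist_le_of_hasUnitSpeedOn hγ hγΩ ⟨hl, le_rfl⟩ h0).trans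
        (ENNReal.ofReal_le_ofReal (by linarith))⟩
  · have hmem : δ ∈ Icc 0 l := ⟨hδ.le, hlδ.le⟩
    refine ⟨⟨γ δ, hγΩ δ hmem⟩, (min_le_left _ _).trans ?_,
      mazurkiewiczDist_le_of_hasUnitSpeedOn hγ hγΩ hmem h0⟩
    rw [div_le_iff₀ hC0, mul_comm]
    refine (hγC δ hmem).2.trans (mul_le_mul_of_nonneg_left ?_ hC0.le)
    exact Metric.infDist_le_infDist_of_subset (compl_subset_compl.2 sdiff_subset) hne

theorem mazurkiewiczDist_le_of_mem_connectedComponentIn {y z : Ω} {x w : X} {δ : ℝ}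
    (hy : (y : X) ∈ connectedComponentIn (Metric.ball w δ ∩ Ω) x)
    (hz : (z : X) ∈ connectedComponentIn (Metric.ball w δ ∩ Ω) x) :
    mazurkiewiczDist Ω y z ≤ ENNReal.ofReal (2 * δ) :=
  mazurkiewiczDist_le_of_subset_closedBall
    ⟨⟨_, hy⟩, isPreconnected_connectedComponentIn⟩
    ((connectedComponentIn_subset _ _).trans inter_subset_right) hy hz
    ((connectedComponentIn_subset _ _).trans (inter_subset_left.trans
      Metric.ball_subset_closedBall))

theorem exists_finite_mazurkiewiczDist_le [ProperSpace X] [LocallyConnectedSpace X]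
    (hΩ : IsOpen Ω) (hbdd : Bornology.IsBounded Ω) {δ η : ℝ} (hδ : 0 < δ) (hη : 0 < η) :
    ∃ t : Set Ω, t.Finite ∧ ∀ z : Ω, η ≤ Metric.infDist (z : X) Ωᶜ →
      ∃ w ∈ t, mazurkiewiczDist Ω z w ≤ ENNReal.ofReal (2 * δ) := by
  have hKc : IsCompact (closure Ω ∩ {z | η ≤ Metric.infDist z Ωᶜ}) :=
    hbdd.isCompact_closure.inter_right
      (isClosed_le continuous_const (Metric.continuous_infDist_pt _))
  have hKΩ : closure Ω ∩ {z | η ≤ Metric.infDist z Ωᶜ} ⊆ Ω := by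
    rintro z ⟨-, hzη⟩
    by_contra hz
    rw [mem_ofPred_eq, Metric.infDist_zero_of_mem (mem_compl hz)] at hzη
    exact hη.not_ge hzη
  have hself : ∀ z ∈ Ω, z ∈ connectedComponentIn (Metric.ball z δ ∩ Ω) z := fun z hz =>
    mem_connectedComponentIn ⟨Metric.mem_ball_self hδ, hz⟩
  obtain ⟨t, ht⟩ := hKc.elim_nhds_subcover'
    (fun z _ => connectedComponentIn (Metric.ball z δ ∩ Ω) z) fun z hz =>
      (Metric.isOpen_ball.inter hΩ).connectedComponentIn.mem_nhds (hself z (hKΩ hz))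
  refine ⟨inclusion hKΩ '' t, t.finite_toSet.image _, fun z hz => ?_⟩
  obtain ⟨w, hwt, hw⟩ := mem_iUnion₂.1 (ht ⟨subset_closure z.2, hz⟩)
  exact ⟨_, mem_image_of_mem _ hwt,
    mazurkiewiczDist_le_of_mem_connectedComponentIn hw (hself w (hKΩ w.2))⟩

theorem totallyBounded_mazurkiewicz [ProperSpace X] [LocallyPathConnectedSpace X]
    (hΩ : IsAlmostJohnDomain Ω) : TotallyBounded (univ : Set (Mazurkiewicz Ω)) := by
  obtain ⟨⟨hopen, hconn, hbdd, huniv⟩, hJ⟩ := hΩ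
  rw [EMetric.totallyBounded_iff]
  intro ε hε
  obtain ⟨a, ha0, ha⟩ := ENNReal.lt_iff_exists_nnreal_btwn.1 hε
  have hδ : 0 < (a / 8 : ℝ) := div_pos (by exact_mod_cast ha0) (by norm_num)
  obtain ⟨F, -, -, hF, hJF⟩ := hJ _ hδ
  obtain ⟨η, hη, hηF⟩ := hJF.exists_mazurkiewiczDist_le hopen huniv hδ
  obtain ⟨t, htfin, ht⟩ := exists_finite_mazurkiewiczDist_le hopen hbdd hδ hη
  refine ⟨t, htfin, fun x _ => ?_⟩
  obtain ⟨y, hyF, hxy⟩ := exists_notMem_mazurkiewiczDist_le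
    (hopen.isConnected_iff_isPathConnected.1 hconn) hF hJF.1.2.1.nonempty x
  obtain ⟨z, hzη, hyz⟩ := hηF y hyF
  obtain ⟨w, hwt, hzw⟩ := ht z hzη
  refine mem_iUnion₂.2 ⟨w, hwt, lt_of_le_of_lt ?_ ha⟩
  calc mazurkiewiczDist Ω x w
      ≤ mazurkiewiczDist Ω x y + mazurkiewiczDist Ω y z + mazurkiewiczDist Ω z w :=
        edist_triangle4 (α := Mazurkiewicz Ω) x y z w
    _ ≤ ENNReal.ofReal (4 * (a / 8)) + ENNReal.ofReal (2 * (a / 8)) +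
        ENNReal.ofReal (2 * (a / 8)) := by gcongr
    _ = a := by
        rw [← ENNReal.ofReal_add (by positivity) (by positivity),
          ← ENNReal.ofReal_add (by positivity) (by positivity), ← ENNReal.ofReal_coe_nnreal]
        congr 1
        ring

end TotallyBounded

section ConnectedSets

variable {Y : Type*} [TopologicalSpace Y]

theorem inter_frontier_nonempty_of_isPreconnected {A U : Set Y} (hA : IsPreconnected A)
    (hmeet : (A ∩ U).Nonempty) (hnot : ¬ A ⊆ U) : (A ∩ frontier U).Nonempty := by
  by_contra hemp
  obtain ⟨a, haA, haU⟩ := hmeet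
  obtain ⟨b, hbA, hbU⟩ := not_subset.1 hnot
  have hfr : ∀ c ∈ A, c ∉ frontier U := fun c hc hcU => hemp ⟨c, hc, hcU⟩
  obtain ⟨c, -, hcint, hcext⟩ := hA (interior U) (closure U)ᶜ isOpen_interior
    isClosed_closure.isOpen_compl
    (fun c hc => or_iff_not_imp_left.2 fun hci hcU => hfr c hc ⟨hcU, hci⟩)
    ⟨a, haA, by_contra fun hai => hfr a haA ⟨subset_closure haU, hai⟩⟩
    ⟨b, hbA, fun hbc => hfr b hbA ⟨hbc, fun hbi => hbU (interior_subset hbi)⟩⟩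
  exact hcext (subset_closure (interior_subset hcint))

theorem disjoint_frontier_connectedComponentIn [LocallyConnectedSpace Y] {V : Set Y}
    (hV : IsOpen V) (x : Y) : Disjoint V (frontier (connectedComponentIn V x)) := by
  refine disjoint_left.2 fun y hyV hy => ?_
  have hyopen : IsOpen (connectedComponentIn V y) := hV.connectedComponentIn
  obtain ⟨w, hwy, hwx⟩ := mem_closure_iff.1 (frontier_subset_closure hy) _ hyopen
    (mem_connectedComponentIn hyV)
  rw [connectedComponentIn_eq hwx, ← connectedComponentIn_eq hwy, hyopen.frontier_eq] at hy
  exact hy.2 (mem_connectedComponentIn hyV)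

theorem areSeparated_sphere {Z : Type*} [PseudoMetricSpace Z] (x : Z) {r s : ℝ} (hrs : r < s) :
    Metric.AreSeparated (Metric.sphere x r) (Metric.sphere x s) := by
  refine ⟨ENNReal.ofReal (s - r), by simpa using hrs, fun a ha b hb => ?_⟩
  rw [edist_dist]
  refine ENNReal.ofReal_le_ofReal ?_
  linarith [dist_triangle_left b x a, Metric.mem_sphere.1 ha, Metric.mem_sphere.1 hb]

end ConnectedSets

theorem edist_le_mazurkiewiczDist {X : Type*} [MetricSpace X] {Ω : Set X} (x y : Ω) :
    edist (x : X) y ≤ mazurkiewiczDist Ω x y :=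
  le_iInf₂ fun _ hA => Metric.edist_le_ediam_of_mem hA.2.2.1 hA.2.2.2

namespace MazurkiewiczClosure

variable {X : Type*} [MetricSpace X] {Ω : Set X}

section Trace

/-- The filter on `X` generated by the traces on `Ω` of the neighborhoods of `m`. -/
noncomputable def trace (m : MazurkiewiczClosure Ω) : Filter X :=
  map Subtype.val (comap ofPoint (𝓝 m))

variable {m m' : MazurkiewiczClosure Ω} {A : Set X}

theorem comap_ofPoint_neBot (m : MazurkiewiczClosure Ω) :
    (comap (ofPoint : Ω → MazurkiewiczClosure Ω) (𝓝 m)).NeBot :=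
  (UniformSpace.Completion.isDenseInducing_coe (α := Mazurkiewicz Ω)).comap_nhds_neBot m

instance trace_neBot (m : MazurkiewiczClosure Ω) : (trace m).NeBot :=
  (comap_ofPoint_neBot m).map _

theorem mem_trace : A ∈ trace m ↔ ∃ U ∈ 𝓝 m, ∀ z : Ω, ofPoint z ∈ U → (z : X) ∈ A :=
  mem_map.trans mem_comap

theorem domain_mem_trace (m : MazurkiewiczClosure Ω) : Ω ∈ trace m :=
  mem_trace.2 ⟨univ, univ_mem, fun z _ => z.2⟩

theorem frequently_trace :
    (∃ᶠ x in trace m, x ∈ A) ↔ m ∈ closure (ofPoint '' (Subtype.val ⁻¹' A : Set Ω)) := by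
  rw [trace, frequently_map, frequently_comap, mem_closure_iff_frequently]
  simp only [mem_image, mem_preimage, and_comm]

theorem eventually_mem_trace (h : A ∈ trace m) : ∀ᶠ m' in 𝓝 m, A ∈ trace m' := by
  obtain ⟨U, hU, hUA⟩ := mem_trace.1 h
  exact (eventually_eventually_nhds.2 hU).mono fun m' hm' => mem_trace.2 ⟨U, hm', hUA⟩

theorem disjoint_trace (h : m ≠ m') : Disjoint (trace m) (trace m') :=
  (disjoint_map Subtype.val_injective).2 (disjoint_comap (disjoint_nhds_nhds.2 h))

theorem eq_of_trace_le (h : trace m ≤ trace m') : m = m' :=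
  by_contra fun hne => (trace_neBot m).ne (disjoint_self.1 ((disjoint_trace hne).mono_right h))

theorem exists_mem_trace_mazurkiewiczDist_lt (m : MazurkiewiczClosure Ω) {ε : ℝ≥0∞}
    (hε : 0 < ε) :
    ∃ A ∈ trace m, ∀ x y : Ω, (x : X) ∈ A → (y : X) ∈ A → mazurkiewiczDist Ω x y < ε := by
  have hcauchy : Cauchy (comap (UniformSpace.Completion.coe' (α := Mazurkiewicz Ω)) (𝓝 m)) :=
    cauchy_nhds.comap' (UniformSpace.Completion.comap_coe_eq_uniformity _).le
      (comap_ofPoint_neBot m)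
  obtain ⟨B, hB, hBε⟩ := (EMetric.cauchy_iff.1 hcauchy).2 ε hε
  refine ⟨_, image_mem_map hB, ?_⟩
  rintro x y ⟨x', hx, hxx'⟩ ⟨y', hy, hyy'⟩
  obtain rfl : x' = x := Subtype.ext hxx'
  obtain rfl : y' = y := Subtype.ext hyy'
  exact hBε x' hx y' hy

theorem exists_subset_of_mazurkiewiczDist_lt (hA : A ∈ trace m) :
    ∃ ε > 0, ∀ U ∈ trace m, U ⊆ Ω →
      (∀ x y : Ω, (x : X) ∈ U → (y : X) ∈ U → mazurkiewiczDist Ω x y < ε) → U ⊆ A := by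
  obtain ⟨N, hN, hNA⟩ := mem_trace.1 hA
  obtain ⟨V, hV, hVN⟩ := UniformSpace.mem_nhds_iff.1 hN
  obtain ⟨W, hW, hWV⟩ := comp_mem_uniformity_sets hV
  obtain ⟨ε, hε, hεW⟩ := mem_uniformity_edist.1
    (UniformSpace.Completion.uniformContinuous_coe (Mazurkiewicz Ω) hW)
  refine ⟨ε, hε, fun U hU hUΩ hUε z hz => ?_⟩
  have hnear : {x : X | ∃ w : Ω, x = w ∧ ofPoint w ∈ UniformSpace.ball m W} ∈ trace m :=
    mem_trace.2 ⟨_, UniformSpace.ball_mem_nhds m hW, fun w hw => ⟨w, rfl, hw⟩⟩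
  obtain ⟨_, hwU, w, rfl, hw⟩ := (trace_neBot m).nonempty_of_mem (inter_mem hU hnear)
  exact hNA ⟨z, hUΩ hz⟩ (hVN (hWV ⟨ofPoint w, hw, hεW (hUε w ⟨z, hUΩ hz⟩ hwU hz)⟩))

end Trace

section Proj

theorem uniformContinuous_val :
    UniformContinuous (fun z => z.1 : Mazurkiewicz Ω → X) :=
  (LipschitzWith.of_edist_le (edist_le_mazurkiewiczDist (Ω := Ω))).uniformContinuous

/-- The continuous extension to the Mazurkiewicz closure of the inclusion of `Ω` into `X`. -/
noncomputable def proj : MazurkiewiczClosure Ω → X :=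
  UniformSpace.Completion.extension (fun z => z.1 : Mazurkiewicz Ω → X)

theorem proj_ofPoint (z : Ω) : proj (ofPoint z) = z :=
  UniformSpace.Completion.extension_coe uniformContinuous_val (show Mazurkiewicz Ω from z)

variable [CompleteSpace X]

theorem continuous_proj : Continuous (proj : MazurkiewiczClosure Ω → X) :=
  UniformSpace.Completion.continuous_extension

theorem trace_le_nhds_proj (m : MazurkiewiczClosure Ω) : trace m ≤ 𝓝 (proj m) := by
  have hval : (Subtype.val : Ω → X) = proj ∘ ofPoint := funext fun z => (proj_ofPoint z).symm
  rw [trace, hval, ← map_map]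
  exact (map_mono map_comap_le).trans continuous_proj.continuousAt

theorem proj_mem_closure_of_frequently {m : MazurkiewiczClosure Ω} {A : Set X}
    (h : ∃ᶠ x in trace m, x ∈ A) : proj m ∈ closure A :=
  mem_closure_of_frequently_of_tendsto h (trace_le_nhds_proj m)

theorem proj_mem_closure (m : MazurkiewiczClosure Ω) : proj m ∈ closure Ω :=
  proj_mem_closure_of_frequently (Eventually.frequently (domain_mem_trace m))

theorem proj_mem_frontier_iff (hΩ : IsOpen Ω) {m : MazurkiewiczClosure Ω} :
    proj m ∈ frontier Ω ↔ proj m ∉ Ω := by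
  rw [hΩ.frontier_eq]
  exact and_iff_right (proj_mem_closure m)

end Proj

section Component

/-- `U` is the connected component of `ball (proj m) r ∩ Ω` which contains the points near `m`,
recorded through the properties that are used. -/
structure IsTraceComponent (m : MazurkiewiczClosure Ω) (r : ℝ) (U : Set X) : Prop where
  mem_trace : U ∈ trace m
  isOpen : IsOpen U
  isConnected : IsConnected U
  subset_ball : U ⊆ Metric.ball (proj m) r
  subset_domain : U ⊆ Ω
  frontier_subset : Ω ∩ frontier U ⊆ Metric.sphere (proj m) r

theorem exists_isTraceComponent [CompleteSpace X] [LocallyConnectedSpace X] (hΩ : IsOpen Ω)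
    (m : MazurkiewiczClosure Ω) {r : ℝ} (hr : 0 < r) : ∃ U, IsTraceComponent m r U := by
  have hV : IsOpen (Metric.ball (proj m) r ∩ Ω) := Metric.isOpen_ball.inter hΩ
  obtain ⟨A, hA, hAr⟩ := exists_mem_trace_mazurkiewiczDist_lt m
    (ENNReal.ofReal_pos.2 (half_pos hr))
  have hB : A ∩ Metric.ball (proj m) (r / 2) ∩ Ω ∈ trace m :=
    inter_mem (inter_mem hA (trace_le_nhds_proj m (Metric.ball_mem_nhds _ (half_pos hr))))
      (domain_mem_trace m)
  obtain ⟨z, ⟨hzA, hzr⟩, hzΩ⟩ := (trace_neBot m).nonempty_of_mem hB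
  have hzV : z ∈ Metric.ball (proj m) r ∩ Ω :=
    ⟨Metric.ball_subset_ball (half_le_self hr.le) hzr, hzΩ⟩
  have hUV := connectedComponentIn_subset (Metric.ball (proj m) r ∩ Ω) z
  refine ⟨connectedComponentIn (Metric.ball (proj m) r ∩ Ω) z,
    mem_of_superset hB fun y hy => ?_, hV.connectedComponentIn,
    isConnected_connectedComponentIn_iff.2 hzV, hUV.trans inter_subset_left,
    hUV.trans inter_subset_right, fun y hy => ?_⟩
  · obtain ⟨⟨hyA, -⟩, hyΩ⟩ := hy
    obtain ⟨S, ⟨hS, hSΩ, hyS, hzS⟩, hSr⟩ : ∃ S, ∃ _ : _, Metric.ediam S < _ := by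
      simpa only [mazurkiewiczDist, iInf_lt_iff] using hAr ⟨y, hyΩ⟩ ⟨z, hzΩ⟩ hyA hzA
    suffices hSball : S ⊆ Metric.ball (proj m) r from
      hS.2.subset_connectedComponentIn hzS (subset_inter hSball hSΩ) hyS
    intro a ha
    have haz : edist a z < ENNReal.ofReal (r / 2) :=
      (Metric.edist_le_ediam_of_mem ha hzS).trans_lt hSr
    rw [edist_lt_ofReal] at haz
    rw [Metric.mem_ball] at hzr ⊢
    linarith [dist_triangle a z (proj m)]
  · have hyr : dist y (proj m) ≤ r := Metric.closure_ball_subset_closedBall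
      (closure_mono (hUV.trans inter_subset_left) (frontier_subset_closure hy.2))
    exact hyr.eq_of_not_lt fun hlt =>
      disjoint_left.1 (disjoint_frontier_connectedComponentIn hV z) ⟨hlt, hy.1⟩ hy.2

namespace IsTraceComponent

variable {m : MazurkiewiczClosure Ω} {r s : ℝ} {U V : Set X}

theorem subset_of_le (hU : IsTraceComponent m r U) (hV : IsTraceComponent m s V) (hrs : r ≤ s) :
    U ⊆ V := by
  by_contra hnot
  obtain ⟨y, hyU, hyV⟩ := inter_frontier_nonempty_of_isPreconnected hU.isConnected.isPreconnected
    ((trace_neBot m).nonempty_of_mem (inter_mem hU.mem_trace hV.mem_trace)) hnot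
  have hys : dist y (proj m) = s := hV.frontier_subset ⟨hU.subset_domain hyU, hyV⟩
  exact ((Metric.mem_ball.1 (hU.subset_ball hyU)).trans_le hrs).ne hys

theorem mazurkiewiczDist_le (hU : IsTraceComponent m r U) {x y : Ω} (hx : (x : X) ∈ U)
    (hy : (y : X) ∈ U) : mazurkiewiczDist Ω x y ≤ ENNReal.ofReal (2 * r) :=
  mazurkiewiczDist_le_of_subset_closedBall hU.isConnected hU.subset_domain hx hy
    (hU.subset_ball.trans Metric.ball_subset_closedBall)

end IsTraceComponent

theorem exists_isTraceComponent_subset {m : MazurkiewiczClosure Ω} {A : Set X}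
    (hA : A ∈ trace m) :
    ∃ r > 0, ∀ s < r, ∀ U, IsTraceComponent m s U → U ⊆ A := by
  obtain ⟨ε, hε, hεA⟩ := exists_subset_of_mazurkiewiczDist_lt hA
  obtain ⟨r, hr0, hrε⟩ := ENNReal.lt_iff_exists_nnreal_btwn.1 hε
  have hr0 : (0 : ℝ) < r := by exact_mod_cast hr0
  refine ⟨r / 2, half_pos hr0, fun s hs U hU => hεA U hU.mem_trace hU.subset_domain
    fun x y hx hy => (hU.mazurkiewiczDist_le hx hy).trans_lt (lt_of_le_of_lt ?_ hrε)⟩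
  rw [← ENNReal.ofReal_coe_nnreal]
  exact ENNReal.ofReal_le_ofReal (by linarith)

end Component

section Interior

variable [CompleteSpace X] [LocallyConnectedSpace X]

theorem trace_ofPoint (hΩ : IsOpen Ω) (z : Ω) : trace (ofPoint z) = 𝓝 (z : X) := by
  refine le_antisymm ((trace_le_nhds_proj _).trans_eq (by rw [proj_ofPoint])) fun A hA => ?_
  obtain ⟨r, hr, hrA⟩ := exists_isTraceComponent_subset hA
  obtain ⟨U, hU⟩ := exists_isTraceComponent hΩ (ofPoint z) (half_pos hr)
  have hzU : (z : X) ∈ U := by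
    obtain ⟨N, hN, hNU⟩ := mem_trace.1 hU.mem_trace
    exact hNU z (mem_of_mem_nhds hN)
  exact mem_of_superset (hU.isOpen.mem_nhds hzU) (hrA _ (half_lt_self hr) U hU)

theorem ofPoint_proj (hΩ : IsOpen Ω) {m : MazurkiewiczClosure Ω} (hm : proj m ∈ Ω) :
    ofPoint ⟨proj m, hm⟩ = m :=
  (eq_of_trace_le ((trace_le_nhds_proj m).trans_eq (trace_ofPoint hΩ ⟨proj m, hm⟩).symm)).symm

end Interior

theorem compactSpace_of_totallyBounded (h : TotallyBounded (univ : Set (Mazurkiewicz Ω))) :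
    CompactSpace (MazurkiewiczClosure Ω) := by
  have hrange := (h.image (UniformSpace.Completion.uniformContinuous_coe _)).closure
  rw [image_univ, UniformSpace.Completion.denseRange_coe.closure_range] at hrange
  exact ⟨hrange.isCompact_of_isComplete isComplete_univ⟩

end MazurkiewiczClosure

open MazurkiewiczClosure

section Chains

variable {X : Type*} [MetricSpace X] {Ω : Set X}

namespace EndChain

theorem nonempty (E : EndChain Ω) (k : ℕ) : (E.sets k).Nonempty :=
  (E.acceptable k).2.2.1.nonempty

theorem subset (E : EndChain Ω) (k : ℕ) : E.sets k ⊆ Ω := (E.acceptable k).1.subset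

theorem antitone (E : EndChain Ω) : Antitone E.sets :=
  antitone_nat_of_succ_le E.succ_subset

theorem exists_subset_of_isPreconnected (F : EndChain Ω) (k : ℕ) :
    ∃ ε > 0, ∀ A : Set X, IsPreconnected A → A ⊆ Ω → Metric.ediam A < ε →
      (A ∩ F.sets (k + 1)).Nonempty → A ⊆ F.sets k := by
  obtain ⟨ε, hε0, hε⟩ := F.separated k
  refine ⟨ε, pos_iff_ne_zero.2 hε0, fun A hA hAΩ hdiam hmeet => by_contra fun hnot => ?_⟩
  obtain ⟨a, haA, ha⟩ := inter_frontier_nonempty_of_isPreconnected hA hmeet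
    fun h => hnot (h.trans (F.succ_subset k))
  obtain ⟨b, hbA, hb⟩ := inter_frontier_nonempty_of_isPreconnected hA
    (hmeet.mono (inter_subset_inter_right A (F.succ_subset k))) hnot
  exact ((hε a ⟨hAΩ haA, ha⟩ b ⟨hAΩ hbA, hb⟩).trans
    (Metric.edist_le_ediam_of_mem haA hbA)).not_gt hdiam

/-- The sets of the chain `E` form a basis of the trace on `Ω` of the neighborhoods of `m`. -/
def Represents (E : EndChain Ω) (m : MazurkiewiczClosure Ω) : Prop :=
  (trace m).HasBasis (fun _ => True) E.sets

/-- The impression of the chain `F` in the Mazurkiewicz closure: the points `m` at which all sets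
of `F` accumulate with respect to the Mazurkiewicz distance. -/
def mazurkiewiczImpression (F : EndChain Ω) : Set (MazurkiewiczClosure Ω) :=
  {m | ∀ k, ∃ᶠ x in trace m, x ∈ F.sets k}

variable {E F : EndChain Ω} {m m' : MazurkiewiczClosure Ω}

theorem mazurkiewiczImpression_nonempty [CompactSpace (MazurkiewiczClosure Ω)]
    (F : EndChain Ω) : F.mazurkiewiczImpression.Nonempty := by
  simp only [mazurkiewiczImpression, frequently_trace, ← mem_iInter, ofPred_mem_eq]
  refine IsCompact.nonempty_iInter_of_sequence_nonempty_isCompact_isClosed _ (fun k => ?_)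
    (fun k => ?_) isClosed_closure.isCompact fun k => isClosed_closure
  · exact closure_mono (image_mono (preimage_mono (F.succ_subset k)))
  · obtain ⟨z, hz⟩ := F.nonempty k
    exact ⟨_, subset_closure ⟨⟨z, F.subset k hz⟩, hz, rfl⟩⟩

theorem proj_mem_frontier_of_mem_mazurkiewiczImpression [CompleteSpace X]
    (h : m ∈ F.mazurkiewiczImpression) : proj m ∈ frontier Ω :=
  F.impression_subset (mem_iInter.2 fun k => proj_mem_closure_of_frequently (h k))

namespace Represents

theorem mem_mazurkiewiczImpression (h : E.Represents m) : m ∈ E.mazurkiewiczImpression :=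
  fun k => Eventually.frequently (h.mem_of_mem trivial : E.sets k ∈ trace m)

theorem of_equiv (h : E.Represents m) (hEF : E.Divides F) (hFE : F.Divides E) :
    F.Represents m :=
  h.to_hasBasis (fun k _ => (hFE k).imp fun _ hl => ⟨trivial, hl⟩)
    fun k _ => (hEF k).imp fun _ hl => ⟨trivial, hl⟩

theorem eq_of_divides (h : E.Represents m) (h' : F.Represents m') (hEF : E.Divides F) :
    m = m' :=
  eq_of_trace_le ((h.le_basis_iff h').2 fun k _ => (hEF k).imp fun _ hl => ⟨trivial, hl⟩)

theorem divides (h : E.Represents m) (hF : m ∈ F.mazurkiewiczImpression) : E.Divides F := by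
  intro k
  obtain ⟨ε, hε, hk⟩ := F.exists_subset_of_isPreconnected k
  obtain ⟨ε', hε', hεε'⟩ := exists_between hε
  obtain ⟨A, hA, hAε⟩ := exists_mem_trace_mazurkiewiczDist_lt m hε'
  obtain ⟨l, -, hlA⟩ := h.mem_iff.1 hA
  have hl : Metric.ediam (E.sets l) ≤ ε' := Metric.ediam_le fun a ha b hb =>
    (edist_le_mazurkiewiczDist ⟨a, E.subset l ha⟩ ⟨b, E.subset l hb⟩).trans
      (hAε _ _ (hlA ha) (hlA hb)).le
  obtain ⟨z, hzF, hzE⟩ := ((hF (k + 1)).and_eventually (h.mem_of_mem trivial)).exists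
  exact ⟨l, hk _ (E.acceptable l).2.2.1.isPreconnected (E.subset l) (hl.trans_lt hεε')
    ⟨z, hzE, hzF⟩⟩

theorem exists_subset_of_mem_nhds [CompleteSpace X] (h : E.Represents m) {V : Set X}
    (hV : V ∈ 𝓝 (proj m)) : ∃ k, E.sets k ⊆ V := by
  simpa only [true_and] using h.mem_iff.1 (trace_le_nhds_proj m hV)

theorem impression_eq [CompleteSpace X] (h : E.Represents m) : E.impression = {proj m} := by
  refine Subset.antisymm (fun x hx => eq_of_forall_dist_le fun ε hε => ?_)
    (singleton_subset_iff.2 (mem_iInter.2 fun k =>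
      proj_mem_closure_of_frequently (h.mem_mazurkiewiczImpression k)))
  obtain ⟨k, hk⟩ := h.exists_subset_of_mem_nhds (Metric.closedBall_mem_nhds _ hε)
  exact closure_minimal hk Metric.isClosed_closedBall (mem_iInter.1 hx k)

end Represents

/-- The chain of open sets cut out near `m` by balls around `proj m` of radii shrinking to `0`. -/
def ofIsTraceComponent (hm : proj m ∈ frontier Ω) {R : ℕ → ℝ} {U : ℕ → Set X}
    (hU : ∀ k, IsTraceComponent m (R k) (U k)) (hproper : ∀ k, U k ≠ Ω) (hR : StrictAnti R)
    (hlim : Tendsto R atTop (𝓝 0)) [CompleteSpace X] : EndChain Ω where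
  sets := U
  acceptable k := ⟨(hU k).subset_domain.ssubset_of_ne (hproper k),
    Metric.isBounded_ball.subset (hU k).subset_ball, (hU k).isConnected, proj m,
    proj_mem_closure_of_frequently (Eventually.frequently (hU k).mem_trace), hm⟩
  succ_subset k := (hU (k + 1)).subset_of_le (hU k) (hR k.lt_succ_self).le
  separated k := (areSeparated_sphere (proj m) (hR k.lt_succ_self)).mono
    (hU (k + 1)).frontier_subset (hU k).frontier_subset
  impression_subset y hy := by
    have hyR : ∀ k, dist y (proj m) ≤ R k := fun k =>
      closure_minimal ((hU k).subset_ball.trans Metric.ball_subset_closedBall)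
        Metric.isClosed_closedBall (mem_iInter.1 hy k)
    rwa [dist_le_zero.1 (ge_of_tendsto' hlim hyR)]

theorem exists_represents [CompleteSpace X] [LocallyConnectedSpace X] (hΩ : IsOpen Ω)
    (hm : proj m ∈ frontier Ω) :
    ∃ E : EndChain Ω, E.Represents m ∧ ∀ k, IsOpen (E.sets k) := by
  have hmΩ : proj m ∉ Ω := (proj_mem_frontier_iff hΩ).1 hm
  obtain ⟨w, hw⟩ : Ω.Nonempty := closure_nonempty_iff.1 ⟨_, frontier_subset_closure hm⟩
  have hw0 : 0 < dist w (proj m) := dist_pos.2 fun h => hmΩ (h ▸ hw)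
  obtain ⟨R, hanti, hR, hlim⟩ := exists_seq_strictAnti_tendsto' hw0
  choose U hU using fun k => exists_isTraceComponent hΩ m (hR k).1
  have hproper : ∀ k, U k ≠ Ω := fun k h =>
    (hR k).2.not_gt ((hU k).subset_ball (h.symm ▸ hw))
  refine ⟨ofIsTraceComponent hm hU hproper hanti hlim, ⟨fun A => ⟨fun hA => ?_, ?_⟩⟩,
    fun k => (hU k).isOpen⟩
  · obtain ⟨r, hr, hrA⟩ := exists_isTraceComponent_subset hA
    obtain ⟨k, hk⟩ := (hlim.eventually_lt_const hr).exists
    exact ⟨k, trivial, hrA _ hk _ (hU k)⟩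
  · rintro ⟨k, -, hk⟩
    exact mem_of_superset (hU k).mem_trace hk

theorem exists_represents_of_mem_mazurkiewiczImpression [CompleteSpace X]
    [LocallyConnectedSpace X] (hΩ : IsOpen Ω) (h : m ∈ F.mazurkiewiczImpression) :
    ∃ E : EndChain Ω, E.Represents m ∧ E.Divides F :=
  (exists_represents hΩ (proj_mem_frontier_of_mem_mazurkiewiczImpression h)).imp
    fun _ hE => ⟨hE.1, hE.1.divides h⟩

theorem Represents.isPrime [CompleteSpace X] [LocallyConnectedSpace X]
    [CompactSpace (MazurkiewiczClosure Ω)] (hΩ : IsOpen Ω) (h : E.Represents m) :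
    (DomainEnd.mk E).IsPrime := by
  rintro ⟨G⟩ (hGE : G.Divides E)
  obtain ⟨m', hm'⟩ := G.mazurkiewiczImpression_nonempty
  obtain ⟨E', hE', hE'G⟩ := exists_represents_of_mem_mazurkiewiczImpression hΩ hm'
  obtain rfl := hE'.eq_of_divides h (hE'G.trans hGE)
  exact Quotient.sound ⟨hGE, (h.divides hE'.mem_mazurkiewiczImpression).trans hE'G⟩

theorem represents_of_isPrime [CompleteSpace X] [LocallyConnectedSpace X] (hΩ : IsOpen Ω)
    (hF : (DomainEnd.mk F).IsPrime) (h : m ∈ F.mazurkiewiczImpression) : F.Represents m := by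
  obtain ⟨E, hE, hEF⟩ := exists_represents_of_mem_mazurkiewiczImpression hΩ h
  obtain ⟨hEF, hFE⟩ := Quotient.exact (hF (DomainEnd.mk E) hEF)
  exact hE.of_equiv hEF hFE

end EndChain

theorem exists_proj_eq [CompleteSpace X] [CompactSpace (MazurkiewiczClosure Ω)] {x : X}
    (hx : x ∈ closure Ω) : ∃ m : MazurkiewiczClosure Ω, proj m = x :=
  have hsub : closure Ω ⊆ range (proj : MazurkiewiczClosure Ω → X) :=
    closure_minimal (fun z hz => ⟨ofPoint ⟨z, hz⟩, proj_ofPoint ⟨z, hz⟩⟩)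
      (isCompact_range continuous_proj).isClosed
  hsub hx

section Ends

variable [CompleteSpace X] [LocallyConnectedSpace X] [CompactSpace (MazurkiewiczClosure Ω)]

theorem DomainEnd.exists_isPrime_divides (hΩ : IsOpen Ω) (e : DomainEnd Ω) :
    ∃ f : DomainEnd Ω, f.IsPrime ∧ f.Divides e := by
  obtain ⟨F⟩ := e
  obtain ⟨m, hm⟩ := F.mazurkiewiczImpression_nonempty
  obtain ⟨E, hE, hEF⟩ := EndChain.exists_represents_of_mem_mazurkiewiczImpression hΩ hm
  exact ⟨DomainEnd.mk E, hE.isPrime hΩ, hEF⟩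

theorem DomainEnd.IsPrime.exists_represents (hΩ : IsOpen Ω) {e : DomainEnd Ω} (he : e.IsPrime) :
    ∃ E m, DomainEnd.mk E = e ∧ E.Represents m := by
  obtain ⟨E⟩ := e
  obtain ⟨m, hm⟩ := E.mazurkiewiczImpression_nonempty
  exact ⟨E, m, rfl, EndChain.represents_of_isPrime hΩ he hm⟩

theorem DomainEnd.IsPrime.exists_impression_eq (hΩ : IsOpen Ω) {e : DomainEnd Ω}
    (he : e.IsPrime) : ∃ x : X, e.impression = {x} := by
  obtain ⟨E, m, rfl, hE⟩ := he.exists_represents hΩ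
  exact ⟨_, hE.impression_eq⟩

theorem exists_represents_of_mem_frontier (hΩ : IsOpen Ω) {x : X} (hx : x ∈ frontier Ω) :
    ∃ (E : EndChain Ω) (m : MazurkiewiczClosure Ω), E.Represents m ∧
      (∀ k, IsOpen (E.sets k)) ∧ E.impression = {x} := by
  obtain ⟨m, rfl⟩ := exists_proj_eq (frontier_subset_closure hx)
  obtain ⟨E, hE, hEopen⟩ := EndChain.exists_represents hΩ hx
  exact ⟨E, m, hE, hEopen, hE.impression_eq⟩

end Ends

end Chains

section Accessible

variable {Y : Type*} [TopologicalSpace Y]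

theorem continuousOn_Ici_zero_of_Icc {g : ℝ → Y}
    (h : ∀ n : ℕ, ContinuousOn g (Icc n (n + 1))) : ContinuousOn g (Ici 0) := by
  have hinit : ∀ n : ℕ, ContinuousOn g (Icc 0 n) := by
    intro n
    induction n with
    | zero => simp
    | succ n ih =>
      push_cast
      rw [← Icc_union_Icc_eq_Icc n.cast_nonneg (le_add_of_nonneg_right zero_le_one)]
      exact ih.union_of_isClosed (h n) isClosed_Icc isClosed_Icc
  intro t ht
  obtain ⟨n, hn⟩ := exists_nat_gt t
  refine (hinit n t ⟨ht, hn.le⟩).mono_of_mem_nhdsWithin ?_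
  rw [← Ici_inter_Iic]
  exact inter_mem_nhdsWithin _ (Iic_mem_nhds hn)

theorem exists_concatenation {w : ℕ → Y} {S : ℕ → Set Y}
    (h : ∀ k, JoinedIn (S k) (w k) (w (k + 1))) :
    ∃ g : ℝ → Y, ContinuousOn g (Ici 0) ∧ ∀ t, g t ∈ S ⌊t⌋₊ := by
  let p : ∀ k, Path (w k) (w (k + 1)) := fun k => (h k).somePath
  have hpS (k : ℕ) (t : ℝ) : (p k).extend t ∈ S k :=
    (h k).somePath_mem (projIcc 0 1 zero_le_one t)
  have hpiece (k : ℕ) : EqOn (fun t => (p ⌊t⌋₊).extend (t - ⌊t⌋₊))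
      (fun t => (p k).extend (t - k)) (Icc k (k + 1)) := by
    rintro t ⟨hkt, htk⟩
    dsimp only
    rcases htk.lt_or_eq with hlt | rfl
    · rw [(Nat.floor_eq_iff (k.cast_nonneg.trans hkt)).2 ⟨hkt, hlt⟩]
    · rw [← Nat.cast_succ, Nat.floor_natCast]
      simp
  refine ⟨fun t => (p ⌊t⌋₊).extend (t - ⌊t⌋₊), continuousOn_Ici_zero_of_Icc fun k => ?_,
    fun t => hpS _ _⟩
  exact ((p k).continuous_extend.comp (continuous_id.sub continuous_const)).continuousOn.congr
    (hpiece k)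

theorem tendsto_div_one_sub_atTop :
    Tendsto (fun s : ℝ => s / (1 - s)) (𝓝[<] 1) atTop := by
  have hden : Tendsto (fun s : ℝ => 1 - s) (𝓝[<] 1) (𝓝[>] 0) := by
    have hzero := (continuous_const.sub continuous_id).tendsto' (1 : ℝ) (0 : ℝ) (sub_self 1)
    exact tendsto_nhdsWithin_iff.2 ⟨hzero.mono_left inf_le_left,
      eventually_mem_nhdsWithin.mono fun s (hs : s < 1) => sub_pos.2 hs⟩
  exact Tendsto.pos_mul_atTop one_pos (tendsto_id.mono_left inf_le_left)
    hden.inv_tendsto_nhdsGT_zero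

theorem continuousOn_reparametrization {g : ℝ → Y} (hg : ContinuousOn g (Ici 0)) {x : Y}
    (hlim : Tendsto g atTop (𝓝 x)) :
    ContinuousOn (fun s => if s < 1 then g (s / (1 - s)) else x) (Icc 0 1) := by
  rintro s ⟨hs0, hs1⟩
  rcases hs1.lt_or_eq with hlt | rfl
  · have hcont : ContinuousWithinAt (fun s : ℝ => g (s / (1 - s))) (Icc 0 1 ∩ Iio 1) s :=
      (hg _ (div_nonneg hs0 (sub_nonneg.2 hs1))).comp (t := Ici 0)
        (continuousAt_id.div (continuousAt_const.sub continuousAt_id)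
          (sub_pos.2 hlt).ne').continuousWithinAt
        fun u hu => div_nonneg hu.1.1 (sub_nonneg.2 hu.1.2)
    exact (hcont.congr (fun u hu => if_pos hu.2) (if_pos hlt)).mono_of_mem_nhdsWithin
      (inter_mem_nhdsWithin _ (Iio_mem_nhds hlt))
  · rw [← Ico_insert_right zero_le_one, continuousWithinAt_insert_self, ContinuousWithinAt,
      if_neg (lt_irrefl 1)]
    exact ((hlim.comp tendsto_div_one_sub_atTop).congr'
      (eventually_mem_nhdsWithin.mono fun s hs => (if_pos hs).symm)).mono_left
        (nhdsWithin_mono _ Ico_subset_Iio_self)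

theorem isAccessible_of_isOpen_chain {X : Type*} [MetricSpace X] [LocallyPathConnectedSpace X]
    {Ω : Set X} {E : EndChain Ω} (hE : ∀ k, IsOpen (E.sets k)) {x : X} (hx : x ∈ frontier Ω)
    (hlim : ∀ V ∈ 𝓝 x, ∃ k, E.sets k ⊆ V) : IsAccessible Ω x := by
  choose w hw using E.nonempty
  have hjoin (k : ℕ) : JoinedIn (E.sets k) (w k) (w (k + 1)) :=
    ((hE k).isConnected_iff_isPathConnected.1 (E.acceptable k).2.2.1).joinedIn _ (hw k) _
      (E.succ_subset k (hw (k + 1)))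
  obtain ⟨g, hg, hgE⟩ := exists_concatenation hjoin
  have hgx : Tendsto g atTop (𝓝 x) := by
    intro V hV
    obtain ⟨k, hk⟩ := hlim V hV
    refine (eventually_ge_atTop (k : ℝ)).mono fun t ht => ?_
    exact hk (E.antitone (Nat.le_floor ht) (hgE t))
  refine ⟨hx, _, continuousOn_reparametrization hg hgx, if_neg (lt_irrefl 1), fun t ht => ?_⟩
  rw [if_pos ht.2]
  exact E.subset _ (hgE _)

end Accessible

section Homeomorphism

variable {X : Type*} [MetricSpace X] {Ω : Set X} {m m₀ : MazurkiewiczClosure Ω}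

instance : TopologicalSpace.MetrizableSpace (MazurkiewiczClosure Ω) :=
  let _ : MetricSpace (Mazurkiewicz Ω) := UniformSpace.metricSpace _
  inferInstanceAs (TopologicalSpace.MetrizableSpace (UniformSpace.Completion (Mazurkiewicz Ω)))

namespace EndClosure

theorem isClosed_iff {C : Set (EndClosure Ω)} : IsClosed C ↔ IsSeqClosedSet C := by
  rw [← isOpen_compl_iff]
  change Cᶜᶜ ∈ {C | IsSeqClosedSet C} ↔ _
  rw [compl_compl, mem_ofPred_eq]

/-- The points of the Mazurkiewicz closure at which the point or the end `y` accumulates with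
respect to the Mazurkiewicz distance. -/
def clusterSet (y : EndClosure Ω) : Set (MazurkiewiczClosure Ω) :=
  {m | ∀ A, y.LiesIn A → ∃ᶠ x in trace m, x ∈ A}

theorem clusterSet_point (x : Ω) : (point x).clusterSet = {ofPoint x} := by
  have himage : ofPoint '' (Subtype.val ⁻¹' {(x : X)} : Set Ω) = {ofPoint x} := by
    rw [← image_singleton (f := Subtype.val), Subtype.val_injective.preimage_image,
      image_singleton]
  ext m
  refine ⟨fun h => ?_, ?_⟩
  · simpa only [frequently_trace, himage, closure_singleton] using h {(x : X)} rfl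
  · rintro rfl A (hA : (x : X) ∈ A)
    exact frequently_trace.2 (subset_closure ⟨x, hA, rfl⟩)

theorem clusterSet_ofEnd_mk (F : EndChain Ω) :
    (ofEnd (DomainEnd.mk F)).clusterSet = F.mazurkiewiczImpression := by
  refine Subset.antisymm (fun m h k => h _ ⟨k, Subset.rfl⟩) fun m h A => ?_
  rintro ⟨k, hk⟩
  exact (h k).mono hk

theorem clusterSet_nonempty [CompactSpace (MazurkiewiczClosure Ω)] (y : EndClosure Ω) :
    y.clusterSet.Nonempty := by
  obtain x | ⟨⟨F⟩⟩ := y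
  · exact (clusterSet_point x).symm ▸ singleton_nonempty _
  · exact (clusterSet_ofEnd_mk F).symm ▸ F.mazurkiewiczImpression_nonempty

theorem mem_clusterSet_of_convergesTo [CompleteSpace X] [LocallyConnectedSpace X]
    (hΩ : IsOpen Ω) {y : ℕ → EndClosure Ω} {b : EndClosure Ω} {m : ℕ → MazurkiewiczClosure Ω}
    (h : ∀ n, m n ∈ (y n).clusterSet) (hm : Tendsto m atTop (𝓝 m₀)) (hy : ConvergesTo y b) :
    m₀ ∈ b.clusterSet := by
  obtain x | ⟨⟨F⟩⟩ := b
  · have hproj : Tendsto (fun n => proj (m n)) atTop (𝓝 (x : X)) := by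
      refine Metric.tendsto_nhds.2 fun ε hε => (hy ε hε).mono fun n => ?_
      rintro ⟨z, hz, hzx⟩
      have hmn := h n
      rw [hz, clusterSet_point] at hmn
      rwa [hmn, proj_ofPoint]
    have hm₀ : proj m₀ = x := tendsto_nhds_unique ((continuous_proj.tendsto m₀).comp hm) hproj
    have hmem : proj m₀ ∈ Ω := hm₀ ▸ x.2
    rw [clusterSet_point, mem_singleton_iff, ← ofPoint_proj hΩ hmem]
    exact congrArg ofPoint (Subtype.ext hm₀)
  · refine (clusterSet_ofEnd_mk F).symm ▸ fun k => frequently_trace.2 ?_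
    exact isClosed_closure.mem_of_tendsto hm
      ((hy F rfl k).mono fun n hn => frequently_trace.1 (h n _ hn))

theorem isClosed_clusterSet_inter_nonempty [CompleteSpace X] [LocallyConnectedSpace X]
    [CompactSpace (MazurkiewiczClosure Ω)] (hΩ : IsOpen Ω) {D : Set (MazurkiewiczClosure Ω)}
    (hD : IsClosed D) : IsClosed {y : EndClosure Ω | (y.clusterSet ∩ D).Nonempty} := by
  refine isClosed_iff.2 fun y b hy hb => ?_
  choose m hm hmD using hy
  obtain ⟨m₀, hm₀, φ, hφ, hlim⟩ := hD.isCompact.tendsto_subseq hmD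
  exact ⟨m₀, mem_clusterSet_of_convergesTo hΩ (fun n => hm (φ n)) hlim (hb.comp hφ), hm₀⟩

end EndClosure

namespace PrimeEndClosure

open EndClosure

variable [CompleteSpace X] {y y' b : PrimeEndClosure Ω}

theorem eq_ofPoint_of_mem_clusterSet (hΩ : IsOpen Ω) (h : m ∈ y.1.clusterSet)
    (hm : proj m ∈ Ω) : y = ofPoint ⟨proj m, hm⟩ := by
  obtain ⟨x | ⟨⟨F⟩⟩, hy⟩ := y
  · obtain rfl : m = MazurkiewiczClosure.ofPoint x := (clusterSet_point x).subset h
    exact Subtype.ext (congrArg point (Subtype.ext (proj_ofPoint x).symm))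
  · exact absurd hm ((proj_mem_frontier_iff hΩ).1
      (EndChain.proj_mem_frontier_of_mem_mazurkiewiczImpression
        ((clusterSet_ofEnd_mk F).subset h)))

variable [LocallyConnectedSpace X]

theorem exists_represents_of_mem_clusterSet (hΩ : IsOpen Ω) (h : m ∈ y.1.clusterSet)
    (hm : proj m ∉ Ω) :
    ∃ E : EndChain Ω, y.1 = ofEnd (DomainEnd.mk E) ∧ E.Represents m := by
  obtain ⟨x | ⟨⟨F⟩⟩, hy⟩ := y
  · obtain rfl : m = MazurkiewiczClosure.ofPoint x := (clusterSet_point x).subset h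
    exact absurd ((proj_ofPoint x).symm ▸ x.2) hm
  · exact ⟨F, rfl, EndChain.represents_of_isPrime hΩ (hy _ rfl)
      ((clusterSet_ofEnd_mk F).subset h)⟩

theorem liesIn_of_mem_clusterSet (hΩ : IsOpen Ω) (h : m ∈ y.1.clusterSet) {A : Set X}
    (hA : A ∈ trace m) : y.1.LiesIn A := by
  by_cases hm : proj m ∈ Ω
  · rw [eq_ofPoint_of_mem_clusterSet hΩ h hm]
    rw [← ofPoint_proj hΩ hm, trace_ofPoint hΩ] at hA
    exact mem_of_mem_nhds hA
  · obtain ⟨E, hyE, hE⟩ := exists_represents_of_mem_clusterSet hΩ h hm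
    obtain ⟨k, -, hk⟩ := hE.mem_iff.1 hA
    exact hyE ▸ ⟨k, hk⟩

theorem mem_clusterSet_unique (hΩ : IsOpen Ω) {m' : MazurkiewiczClosure Ω}
    (h : m ∈ y.1.clusterSet) (h' : m' ∈ y.1.clusterSet) : m = m' := by
  by_contra hne
  obtain ⟨A, hA, B, hB, hAB⟩ := Filter.disjoint_iff.1 (disjoint_trace hne)
  obtain ⟨x, hxA, hxB⟩ := ((h' A (liesIn_of_mem_clusterSet hΩ h hA)).and_eventually hB).exists
  exact disjoint_left.1 hAB hxA hxB

theorem eq_of_mem_clusterSet (hΩ : IsOpen Ω) (h : m ∈ y.1.clusterSet)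
    (h' : m ∈ y'.1.clusterSet) : y = y' := by
  by_cases hm : proj m ∈ Ω
  · rw [eq_ofPoint_of_mem_clusterSet hΩ h hm, eq_ofPoint_of_mem_clusterSet hΩ h' hm]
  · obtain ⟨E, hyE, hE⟩ := exists_represents_of_mem_clusterSet hΩ h hm
    obtain ⟨E', hyE', hE'⟩ := exists_represents_of_mem_clusterSet hΩ h' hm
    have hequiv : DomainEnd.mk E = DomainEnd.mk E' := Quotient.sound
      ⟨hE.divides hE'.mem_mazurkiewiczImpression, hE'.divides hE.mem_mazurkiewiczImpression⟩
    exact Subtype.ext (hyE.trans (hequiv ▸ hyE'.symm))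

theorem convergesTo_of_tendsto (hΩ : IsOpen Ω) {y : ℕ → PrimeEndClosure Ω}
    {m : ℕ → MazurkiewiczClosure Ω} (h : ∀ n, m n ∈ (y n).1.clusterSet)
    (hb : m₀ ∈ b.1.clusterSet) (hm : Tendsto m atTop (𝓝 m₀)) :
    ConvergesTo (fun n => (y n).1) b.1 := by
  obtain ⟨x | e, hbP⟩ := b
  · obtain rfl : m₀ = MazurkiewiczClosure.ofPoint x := (clusterSet_point x).subset hb
    have hproj : Tendsto (fun n => proj (m n)) atTop (𝓝 (x : X)) :=
      (continuous_proj.tendsto' _ _ (proj_ofPoint x)).comp hm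
    intro ε hε
    filter_upwards [hproj (hΩ.mem_nhds x.2), Metric.tendsto_nhds.1 hproj ε hε] with n hn hnε
    exact ⟨⟨proj (m n), hn⟩, congrArg Subtype.val (eq_ofPoint_of_mem_clusterSet hΩ (h n) hn), hnε⟩
  · rintro E rfl k
    have hE : E.Represents m₀ :=
      EndChain.represents_of_isPrime hΩ (hbP _ rfl) ((clusterSet_ofEnd_mk E).subset hb)
    filter_upwards [hm (eventually_mem_trace (hE.mem_of_mem trivial))] with n hn
    exact liesIn_of_mem_clusterSet hΩ (h n) hn

variable [CompactSpace (MazurkiewiczClosure Ω)]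

theorem exists_mem_clusterSet (hΩ : IsOpen Ω) (m : MazurkiewiczClosure Ω) :
    ∃ y : PrimeEndClosure Ω, m ∈ y.1.clusterSet := by
  by_cases hm : proj m ∈ Ω
  · exact ⟨ofPoint ⟨proj m, hm⟩, (clusterSet_point _).superset (ofPoint_proj hΩ hm).symm⟩
  · obtain ⟨E, hE, -⟩ := EndChain.exists_represents hΩ ((proj_mem_frontier_iff hΩ).2 hm)
    refine ⟨⟨ofEnd (DomainEnd.mk E), ?_⟩, ?_⟩
    · rintro _ ⟨⟩
      exact hE.isPrime hΩ
    · exact (clusterSet_ofEnd_mk E).symm ▸ hE.mem_mazurkiewiczImpression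

theorem exists_homeomorph_mazurkiewiczClosure (hΩ : IsOpen Ω) :
    ∃ Φ : PrimeEndClosure Ω ≃ₜ MazurkiewiczClosure Ω,
      ∀ x : Ω, Φ (ofPoint x) = MazurkiewiczClosure.ofPoint x := by
  choose f hf using fun y : PrimeEndClosure Ω => y.1.clusterSet_nonempty
  have hf_eq {y : PrimeEndClosure Ω} {m} (h : m ∈ y.1.clusterSet) : f y = m :=
    mem_clusterSet_unique hΩ (hf y) h
  have hbij : Function.Bijective f :=
    ⟨fun y y' h => eq_of_mem_clusterSet hΩ (hf y) (h ▸ hf y'),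
      fun m => (exists_mem_clusterSet hΩ m).imp fun y => hf_eq⟩
  have hcont : Continuous f := by
    refine continuous_iff_isClosed.2 fun D hD => ?_
    convert (isClosed_clusterSet_inter_nonempty hΩ hD).preimage continuous_subtype_val using 1
    refine Subset.antisymm (fun y hy => ⟨f y, hf y, hy⟩) ?_
    rintro y ⟨m, hm, hmD⟩
    exact mem_preimage.2 (hf_eq hm ▸ hmD)
  have hclosed : IsClosedMap f := by
    intro C hC
    obtain ⟨C', hC', rfl⟩ := isClosed_induced_iff.1 hC
    refine IsSeqClosed.isClosed fun m m₀ hm hlim => ?_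
    choose y hyC hym using hm
    obtain ⟨b, rfl⟩ := hbij.2 m₀
    have hconv : ConvergesTo (fun n => (y n).1) b.1 :=
      convergesTo_of_tendsto hΩ (fun n => hym n ▸ hf (y n)) (hf b) hlim
    exact ⟨b, EndClosure.isClosed_iff.1 hC' _ _ hyC hconv, rfl⟩
  exact ⟨(Equiv.ofBijective f hbij).toHomeomorphOfContinuousClosed hcont hclosed,
    fun x => hf_eq ((clusterSet_point x).symm ▸ rfl)⟩

end PrimeEndClosure

end Homeomorphism

section Modulus

theorem volume_image_le_of_lipschitzOnWith_one {f : ℝ → ℝ} {S : Set ℝ}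
    (hf : LipschitzOnWith 1 f S) : volume (f '' S) ≤ volume S := by
  simpa [hausdorffMeasure_real] using hf.hausdorffMeasure_image_le (d := 1) zero_le_one

theorem sum_indicator_rpow_of_pairwiseDisjoint {ι α : Type*} {s : Finset ι} {A : ι → Set α}
    (hA : (s : Set ι).PairwiseDisjoint A) {p : ℝ} (hp : 0 < p) (c : ι → ℝ≥0∞) (y : α) :
    (∑ i ∈ s, (A i).indicator (fun _ => c i) y) ^ p =
      ∑ i ∈ s, (A i).indicator (fun _ => c i ^ p) y := by
  by_cases hy : ∃ j ∈ s, y ∈ A j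
  · obtain ⟨j, hj, hyj⟩ := hy
    have hne : ∀ i ∈ s, i ≠ j → y ∉ A i := fun i hi hij hyi =>
      disjoint_left.1 (hA hi hj hij) hyi hyj
    rw [Finset.sum_eq_single_of_mem j hj fun i hi hij => indicator_of_notMem (hne i hi hij) _,
      Finset.sum_eq_single_of_mem j hj fun i hi hij => indicator_of_notMem (hne i hi hij) _,
      indicator_of_mem hyj, indicator_of_mem hyj]
  · push Not at hy
    rw [Finset.sum_eq_zero fun i hi => indicator_of_notMem (hy i hi) _,
      Finset.sum_eq_zero fun i hi => indicator_of_notMem (hy i hi) _, ENNReal.zero_rpow_of_pos hp]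

variable {X : Type*} [PseudoMetricSpace X]

theorem sum_lineIntegral_le {ι : Type*} (s : Finset ι) (ρ : ι → X → ℝ≥0∞) (γ : RectCurve X) :
    ∑ i ∈ s, lineIntegral (ρ i) γ ≤ lineIntegral (fun y => ∑ i ∈ s, ρ i y) γ := by
  classical
  induction s using Finset.induction_on with
  | empty => simp
  | insert i s hi ih =>
    simp only [Finset.sum_insert hi]
    exact (add_le_add_right ih _).trans (le_lintegral_add _ _)

/-- The rectifiable curves which start at distance at most `r` from `x` and end at distance at
least `R` from `x`. -/
def curvesCrossing (x : X) (r R : ℝ) : Set (RectCurve X) :=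
  {γ | dist (γ.toFun 0) x ≤ r ∧ R ≤ dist (γ.toFun γ.len) x}

/-- The open annulus of radii `R / 2 ^ (i + 1)` and `R / 2 ^ i` around `x`. -/
def dyadicAnnulus (x : X) (R : ℝ) (i : ℕ) : Set X :=
  {y | dist y x ∈ Ioo (R / 2 ^ (i + 1)) (R / 2 ^ i)}

variable {x : X} {r R : ℝ}

theorem curvesCrossing_mono {r' R' : ℝ} (hr : r ≤ r') (hR : R' ≤ R) :
    curvesCrossing x r R ⊆ curvesCrossing x r' R' :=
  fun _ hγ => ⟨hγ.1.trans hr, hR.trans hγ.2⟩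

theorem mul_le_lineIntegral_indicator_annulus {γ : RectCurve X} (hγ : γ ∈ curvesCrossing x r R)
    (c : ℝ≥0∞) :
    c * ENNReal.ofReal (R - r) ≤
      lineIntegral ({y | dist y x ∈ Ioo r R}.indicator fun _ => c) γ := by
  have hlip : LipschitzOnWith 1 (fun t => dist (γ.toFun t) x) (Icc 0 γ.len) := by
    simpa [Function.comp_def] using (LipschitzWith.dist_left x).comp_lipschitzOnWith
      (lipschitzOnWith_one_of_hasUnitSpeedOn γ.unitSpeed)
  set S := Icc 0 γ.len ∩ (fun t => dist (γ.toFun t) x) ⁻¹' Ioo r R with hS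
  have hSm : MeasurableSet S := by
    obtain ⟨V, hV, hVS⟩ := continuousOn_iff'.1 hlip.continuousOn (Ioo r R) isOpen_Ioo
    rw [hS, inter_comm, hVS]
    exact hV.measurableSet.inter measurableSet_Icc
  have himage : Ioo r R ⊆ (fun t => dist (γ.toFun t) x) '' S := fun s hs => by
    obtain ⟨t, ht, rfl⟩ := intermediate_value_Icc γ.len_pos.le hlip.continuousOn
      ⟨hγ.1.trans hs.1.le, hs.2.le.trans hγ.2⟩
    exact ⟨t, ⟨ht, hs⟩, rfl⟩
  have hvol : ENNReal.ofReal (R - r) ≤ volume S := calc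
    ENNReal.ofReal (R - r) = volume (Ioo r R) := Real.volume_Ioo.symm
    _ ≤ _ := measure_mono himage
    _ ≤ volume S := volume_image_le_of_lipschitzOnWith_one (hlip.mono inter_subset_left)
  calc c * ENNReal.ofReal (R - r) ≤ c * volume S := by gcongr
    _ = ∫⁻ _ in S, c := (setLIntegral_const _ _).symm
    _ = ∫⁻ t in S, {y | dist y x ∈ Ioo r R}.indicator (fun _ => c) (γ.toFun t) :=
      setLIntegral_congr_fun hSm fun t ht => by rw [indicator_of_mem (by exact ht.2)]
    _ ≤ _ := lintegral_mono_set inter_subset_left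

theorem dyadic_antitone (hR : 0 ≤ R) : Antitone fun i : ℕ => R / 2 ^ i := fun _ _ hij =>
  div_le_div_of_nonneg_left hR (by positivity) (pow_le_pow_right₀ one_le_two hij)

theorem pairwise_disjoint_dyadicAnnulus (hR : 0 ≤ R) :
    Pairwise (Function.onFun Disjoint (dyadicAnnulus x R)) := by
  refine (pairwise_disjoint_on _).2 fun i j hij => disjoint_left.2 fun y hi hj => ?_
  exact (hi.1.trans hj.2).not_ge (dyadic_antitone hR hij)

theorem mul_le_lineIntegral_indicator_dyadicAnnulus (hR : 0 ≤ R) {i N : ℕ} (hi : i < N)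
    {γ : RectCurve X} (hγ : γ ∈ curvesCrossing x (R / 2 ^ N) R) (c : ℝ≥0∞) :
    c * ENNReal.ofReal (R / 2 ^ (i + 1)) ≤
      lineIntegral ((dyadicAnnulus x R i).indicator fun _ => c) γ := by
  have hwidth : R / 2 ^ i - R / 2 ^ (i + 1) = R / 2 ^ (i + 1) := by
    rw [pow_succ]
    ring
  rw [← hwidth]
  exact mul_le_lineIntegral_indicator_annulus (curvesCrossing_mono (dyadic_antitone hR hi)
    (div_le_self hR (one_le_pow₀ one_le_two)) hγ) c

variable [MeasurableSpace X] {μ : Measure X} {p q : ℝ}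

theorem modulus_mono {Γ Γ' : Set (RectCurve X)} (h : Γ ⊆ Γ') : modulus μ p Γ ≤ modulus μ p Γ' :=
  le_iInf₂ fun ρ hρ => le_iInf fun hΓ =>
    (iInf₂_le ρ hρ).trans (iInf_le _ fun γ hγ => hΓ γ (h hγ))

theorem exists_measure_ball_le_of_mem_dimSet (hball : BallsPosFinite μ) (hq : q ∈ dimSet μ x) :
    ∃ D R₀ : ℝ, 0 ≤ D ∧ 0 < R₀ ∧ ∀ r, 0 < r → r ≤ R₀ →
      μ (Metric.ball x r) ≤ ENNReal.ofReal (D * r ^ q) := by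
  obtain ⟨-, C, hC, R₀, hR₀, h⟩ := hq
  have hpos : 0 < μ.real (Metric.ball x R₀) :=
    ENNReal.toReal_pos (hball x R₀ hR₀).1.ne' (hball.measure_ball_lt_top x R₀).ne
  refine ⟨C * μ.real (Metric.ball x R₀) / R₀ ^ q, R₀, by positivity, hR₀, fun r hr hrR => ?_⟩
  rw [← ENNReal.ofReal_toReal (hball.measure_ball_lt_top x r).ne]
  refine ENNReal.ofReal_le_ofReal ?_
  calc μ.real (Metric.ball x r) ≤ C * (r / R₀) ^ q * μ.real (Metric.ball x R₀) :=
        (div_le_iff₀ hpos).1 (h r R₀ hr hrR le_rfl)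
    _ = C * μ.real (Metric.ball x R₀) / R₀ ^ q * r ^ q := by
        rw [Real.div_rpow hr.le hR₀.le]
        ring

theorem mem_dimSet_of_le (hq : q ∈ dimSet μ x) {s : ℝ} (hs : 0 < s) (hsq : s ≤ q) :
    s ∈ dimSet μ x := by
  obtain ⟨-, C, hC, R₀, hR₀, h⟩ := hq
  refine ⟨hs, C, hC, R₀, hR₀, fun r R hr hrR hR => (h r R hr hrR hR).trans ?_⟩
  have hRpos : 0 < R := hr.trans_le hrR
  gcongr ?_ * ?_
  exact Real.rpow_le_rpow_of_exponent_ge (by positivity) ((div_le_one hRpos).2 hrR) hsq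

theorem exists_one_lt_mem_dimSet (hone : 1 ∈ dimSet μ x) (hne : dimSet μ x ≠ Ioc 0 1) :
    ∃ q ∈ dimSet μ x, 1 < q := by
  by_contra! hle
  exact hne (Subset.antisymm (fun q hq => ⟨hq.1, hle q hq⟩)
    fun q hq => mem_dimSet_of_le hone hq.1 hq.2)

theorem ofReal_rpow_mul_measure_ball_le (hp : 0 < p) (hpq : p ≤ q) {D s a : ℝ} (hD : 0 ≤ D)
    (ha : 0 ≤ a) (hs : 0 < s) (hsR : s ≤ R)
    (hball : μ (Metric.ball x s) ≤ ENNReal.ofReal (D * s ^ q)) :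
    ENNReal.ofReal (a / s) ^ p * μ (Metric.ball x s) ≤
      ENNReal.ofReal (D * a ^ p * R ^ (q - p)) := by
  calc ENNReal.ofReal (a / s) ^ p * μ (Metric.ball x s)
      ≤ ENNReal.ofReal (a / s) ^ p * ENNReal.ofReal (D * s ^ q) := by gcongr
    _ = ENNReal.ofReal (D * a ^ p * s ^ (q - p)) := by
        rw [ENNReal.ofReal_rpow_of_nonneg (by positivity) hp.le,
          ← ENNReal.ofReal_mul (by positivity), Real.div_rpow ha hs.le, Real.rpow_sub hs]
        congr 1
        ring
    _ ≤ _ := by gcongr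

section Estimate

variable [OpensMeasurableSpace X]

theorem measurableSet_dyadicAnnulus (i : ℕ) : MeasurableSet (dyadicAnnulus x R i) :=
  (isOpen_Ioo.preimage (continuous_id.dist continuous_const)).measurableSet

theorem modulus_curvesCrossing_le_sum (hp : 0 < p) (hR : 0 ≤ R) {N : ℕ} {c : ℕ → ℝ≥0∞}
    (hc : 1 ≤ ∑ i ∈ Finset.range N, c i * ENNReal.ofReal (R / 2 ^ (i + 1))) :
    modulus μ p (curvesCrossing x (R / 2 ^ N) R) ≤
      ∑ i ∈ Finset.range N, c i ^ p * μ (Metric.ball x (R / 2 ^ i)) := by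
  let ρ : X → ℝ≥0∞ := fun y =>
    ∑ i ∈ Finset.range N, (dyadicAnnulus x R i).indicator (fun _ => c i) y
  have hρ : Measurable ρ := Finset.measurable_sum _ fun i _ =>
    measurable_const.indicator (measurableSet_dyadicAnnulus i)
  have hadm : ∀ γ ∈ curvesCrossing x (R / 2 ^ N) R, 1 ≤ lineIntegral ρ γ := fun γ hγ => calc
    1 ≤ _ := hc
    _ ≤ ∑ i ∈ Finset.range N, lineIntegral ((dyadicAnnulus x R i).indicator fun _ => c i) γ :=
      Finset.sum_le_sum fun i hi =>
        mul_le_lineIntegral_indicator_dyadicAnnulus hR (Finset.mem_range.1 hi) hγ (c i)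
    _ ≤ _ := sum_lineIntegral_le _ _ γ
  calc modulus μ p (curvesCrossing x (R / 2 ^ N) R) ≤ ∫⁻ y, ρ y ^ p ∂μ :=
        (iInf₂_le ρ hρ).trans (iInf_le _ hadm)
    _ = ∫⁻ y, ∑ i ∈ Finset.range N, (dyadicAnnulus x R i).indicator (fun _ => c i ^ p) y ∂μ :=
        lintegral_congr fun y => sum_indicator_rpow_of_pairwiseDisjoint
          ((pairwise_disjoint_dyadicAnnulus hR).set_pairwise _) hp c y
    _ = ∑ i ∈ Finset.range N, c i ^ p * μ (dyadicAnnulus x R i) := by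
        rw [lintegral_finsetSum _ fun i _ =>
          measurable_const.indicator (measurableSet_dyadicAnnulus i)]
        simp only [lintegral_indicator_const (measurableSet_dyadicAnnulus _)]
    _ ≤ _ := by
        gcongr with i
        exact fun y hy => hy.2

theorem modulus_curvesCrossing_le (hp : 0 < p) (hpq : p ≤ q) {D R₀ : ℝ} (hD : 0 ≤ D)
    (hball : ∀ r, 0 < r → r ≤ R₀ → μ (Metric.ball x r) ≤ ENNReal.ofReal (D * r ^ q))
    (hR : 0 < R) (hRR₀ : R ≤ R₀) {N : ℕ} (hN : 0 < N) :
    modulus μ p (curvesCrossing x (R / 2 ^ N) R) ≤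
      ENNReal.ofReal (D * 2 ^ p * N ^ (1 - p) * R ^ (q - p)) := by
  have hN' : (0 : ℝ) < N := by exact_mod_cast hN
  let c : ℕ → ℝ≥0∞ := fun i => ENNReal.ofReal (2 / N / (R / 2 ^ i))
  have hc : ∑ i ∈ Finset.range N, c i * ENNReal.ofReal (R / 2 ^ (i + 1)) = 1 := by
    have hterm (i : ℕ) : c i * ENNReal.ofReal (R / 2 ^ (i + 1)) = (N : ℝ≥0∞)⁻¹ := by
      rw [← ENNReal.ofReal_mul (by positivity), ← ENNReal.ofReal_natCast,
        ← ENNReal.ofReal_inv_of_pos hN']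
      congr 1
      field_simp
      ring
    simp only [hterm, Finset.sum_const, Finset.card_range, nsmul_eq_mul]
    exact ENNReal.mul_inv_cancel (by exact_mod_cast hN.ne') (ENNReal.natCast_ne_top N)
  have hterm (i : ℕ) : c i ^ p * μ (Metric.ball x (R / 2 ^ i)) ≤
      ENNReal.ofReal (D * (2 / N) ^ p * R ^ (q - p)) := by
    have hRi : R / 2 ^ i ≤ R := div_le_self hR.le (one_le_pow₀ one_le_two)
    have hRi0 : 0 < R / 2 ^ i := by positivity
    exact ofReal_rpow_mul_measure_ball_le hp hpq hD (by positivity) hRi0 hRi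
      (hball _ hRi0 (hRi.trans hRR₀))
  refine (modulus_curvesCrossing_le_sum hp hR.le hc.ge).trans
    ((Finset.sum_le_sum fun i _ => hterm i).trans_eq ?_)
  rw [Finset.sum_const, Finset.card_range, nsmul_eq_mul, ← ENNReal.ofReal_natCast,
    ← ENNReal.ofReal_mul hN'.le, Real.div_rpow zero_le_two hN'.le, Real.rpow_sub hN',
    Real.rpow_one]
  congr 1
  ring

theorem exists_modulus_curvesCrossing_le_of_lt (hp : 0 < p) (hpq : p < q)
    (hball : BallsPosFinite μ) (hq : q ∈ dimSet μ x) (hR : 0 < R) {η : ℝ} (hη : 0 < η) :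
    ∃ r > 0, modulus μ p (curvesCrossing x r R) ≤ ENNReal.ofReal η := by
  obtain ⟨D, R₀, hD, hR₀, hball⟩ := exists_measure_ball_le_of_mem_dimSet hball hq
  have hlim : Tendsto (fun s : ℝ => D * 2 ^ p * (1 : ℕ) ^ (1 - p) * s ^ (q - p)) (𝓝 0) (𝓝 0) := by
    have hzero := (Real.continuousAt_rpow_const 0 (q - p) (Or.inr (sub_pos.2 hpq).le)).tendsto
    rw [Real.zero_rpow (sub_pos.2 hpq).ne'] at hzero
    simpa using hzero.const_mul (D * 2 ^ p * (1 : ℕ) ^ (1 - p))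
  have hsmall : ∀ᶠ s in 𝓝[>] (0 : ℝ), s ∈ Ioc 0 (min R R₀) := Ioc_mem_nhdsGT (lt_min hR hR₀)
  obtain ⟨s, ⟨hs0, hs⟩, hsη⟩ :=
    (hsmall.and ((hlim.mono_left nhdsWithin_le_nhds).eventually_lt_const hη)).exists
  refine ⟨s / 2 ^ 1, by positivity, ?_⟩
  calc modulus μ p (curvesCrossing x (s / 2 ^ 1) R)
      ≤ modulus μ p (curvesCrossing x (s / 2 ^ 1) s) :=
        modulus_mono (curvesCrossing_mono le_rfl (hs.trans (min_le_left _ _)))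
    _ ≤ _ := modulus_curvesCrossing_le hp hpq.le hD hball hs0 (hs.trans (min_le_right _ _)) one_pos
    _ ≤ ENNReal.ofReal η := ENNReal.ofReal_le_ofReal hsη.le

theorem exists_modulus_curvesCrossing_le_of_one_lt (hp : 1 < p) (hball : BallsPosFinite μ)
    (hpx : p ∈ dimSet μ x) (hR : 0 < R) {η : ℝ} (hη : 0 < η) :
    ∃ r > 0, modulus μ p (curvesCrossing x r R) ≤ ENNReal.ofReal η := by
  obtain ⟨D, R₀, hD, hR₀, hball⟩ := exists_measure_ball_le_of_mem_dimSet hball hpx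
  have hS : 0 < min R R₀ := lt_min hR hR₀
  have hlim : Tendsto (fun N : ℕ => D * 2 ^ p * (N : ℝ) ^ (1 - p) * min R R₀ ^ (p - p))
      atTop (𝓝 0) := by
    have hzero := (tendsto_rpow_neg_atTop (sub_pos.2 hp)).comp tendsto_natCast_atTop_atTop
    simpa [Function.comp_def] using hzero.const_mul (D * 2 ^ p)
  obtain ⟨N, hNη, hN⟩ := ((hlim.eventually_lt_const hη).and (eventually_gt_atTop 0)).exists
  refine ⟨min R R₀ / 2 ^ N, by positivity, ?_⟩
  calc modulus μ p (curvesCrossing x (min R R₀ / 2 ^ N) R)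
      ≤ modulus μ p (curvesCrossing x (min R R₀ / 2 ^ N) (min R R₀)) :=
        modulus_mono (curvesCrossing_mono le_rfl (min_le_left _ _))
    _ ≤ _ := modulus_curvesCrossing_le (one_pos.trans hp) le_rfl hD hball hS (min_le_right _ _) hN
    _ ≤ ENNReal.ofReal η := ENNReal.ofReal_le_ofReal hNη.le

theorem exists_modulus_curvesCrossing_le (hp : 1 ≤ p) (hball : BallsPosFinite μ)
    (hpx : p ∈ dimSet μ x) (hne : dimSet μ x ≠ Ioc 0 1) (hR : 0 < R) {η : ℝ} (hη : 0 < η) :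
    ∃ r > 0, modulus μ p (curvesCrossing x r R) ≤ ENNReal.ofReal η := by
  rcases hp.eq_or_lt with rfl | hp
  · obtain ⟨q, hq, hq1⟩ := exists_one_lt_mem_dimSet hpx hne
    exact exists_modulus_curvesCrossing_le_of_lt one_pos hq1 hball hq hR hη
  · exact exists_modulus_curvesCrossing_le_of_one_lt hp hball hpx hR hη

end Estimate

end Modulus

section ModEnds

variable {X : Type*} [MetricSpace X] {Ω : Set X} [MeasurableSpace X] [OpensMeasurableSpace X]
  {μ : Measure X} {p : ℝ}

theorem EndChain.isModChain_of_forall_mem_nhds {E : EndChain Ω} {x : X} (hp : 1 ≤ p)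
    (hball : BallsPosFinite μ) (hpx : p ∈ dimSet μ x) (hne : dimSet μ x ≠ Ioc 0 1) (hx : x ∉ Ω)
    (hlim : ∀ V ∈ 𝓝 x, ∃ k, E.sets k ⊆ V) : E.IsModChain μ p := by
  intro K hK hKΩ
  obtain ⟨R, hR, hRK⟩ := Metric.mem_nhds_iff.1 (hK.isClosed.isOpen_compl.mem_nhds
    fun h : x ∈ K => hx (hKΩ h))
  refine ENNReal.tendsto_nhds_zero.2 fun η hη => ?_
  obtain ⟨a, ha0, haη⟩ := ENNReal.lt_iff_exists_nnreal_btwn.1 hη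
  obtain ⟨r, hr, hmod⟩ :=
    exists_modulus_curvesCrossing_le hp hball hpx hne hR (η := a) (by exact_mod_cast ha0)
  obtain ⟨k, hk⟩ := hlim _ (Metric.closedBall_mem_nhds x hr)
  filter_upwards [eventually_ge_atTop k] with l hl
  have hsub : curvesJoining (E.sets l) K Ω ⊆ curvesCrossing x r R := fun γ hγ =>
    ⟨hk (E.antitone hl hγ.2.1), not_lt.1 fun h => hRK h hγ.2.2⟩
  calc modulus μ p (curvesJoining (E.sets l) K Ω) ≤ modulus μ p (curvesCrossing x r R) :=
        modulus_mono hsub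
    _ ≤ ENNReal.ofReal a := hmod
    _ ≤ η := by
        rw [ENNReal.ofReal_coe_nnreal]
        exact haη.le

namespace DomainEnd

variable [CompleteSpace X] [LocallyConnectedSpace X] [CompactSpace (MazurkiewiczClosure Ω)]

theorem IsPrime.isModEnd (hΩ : IsOpen Ω) (hp : 1 ≤ p) (hball : BallsPosFinite μ)
    (hdim : ∀ x ∈ frontier Ω, p ∈ dimSet μ x ∧ dimSet μ x ≠ Ioc 0 1) {e : DomainEnd Ω}
    (he : e.IsPrime) : e.IsModEnd μ p := by
  obtain ⟨E, m, rfl, hE⟩ := he.exists_represents hΩ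
  have hm : proj m ∈ frontier Ω :=
    EndChain.proj_mem_frontier_of_mem_mazurkiewiczImpression hE.mem_mazurkiewiczImpression
  exact ⟨E, E.isModChain_of_forall_mem_nhds hp hball (hdim _ hm).1 (hdim _ hm).2
    ((proj_mem_frontier_iff hΩ).1 hm) fun _ => hE.exists_subset_of_mem_nhds, rfl⟩

theorem isPrime_iff_isModPrime (hΩ : IsOpen Ω) (hp : 1 ≤ p) (hball : BallsPosFinite μ)
    (hdim : ∀ x ∈ frontier Ω, p ∈ dimSet μ x ∧ dimSet μ x ≠ Ioc 0 1) {e : DomainEnd Ω} :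
    e.IsPrime ↔ e.IsModPrime μ p := by
  refine ⟨fun he => ⟨he.isModEnd hΩ hp hball hdim, fun f _ hf => he f hf⟩, fun he => ?_⟩
  obtain ⟨f, hf, hfe⟩ := exists_isPrime_divides hΩ e
  rwa [← he.2 f (hf.isModEnd hΩ hp hball hdim) hfe]

end DomainEnd

end ModEnds

end PrimeEnds

theorem mainTheorem7 {X : Type*} [MetricSpace X] [CompleteSpace X]
    [MeasurableSpace X] [BorelSpace X] (μ : Measure X) (p : ℝ) (hp : 1 ≤ p)
    (hball : PrimeEnds.BallsPosFinite μ) (hdoubling : PrimeEnds.IsDoubling μ)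
    (hpoincare : PrimeEnds.SupportsPoincare μ p)
    (Ω : Set X) (hΩ : PrimeEnds.IsAlmostJohnDomain Ω) :
    (∀ e : PrimeEnds.DomainEnd Ω, ∃ f : PrimeEnds.DomainEnd Ω, f.IsPrime ∧ f.Divides e) ∧
    (∀ e : PrimeEnds.DomainEnd Ω, e.IsPrime → ∃ x : X, e.impression = {x}) ∧
    (∀ x ∈ frontier Ω, PrimeEnds.IsAccessible Ω x ∧
      ∃ e : PrimeEnds.DomainEnd Ω, e.IsPrime ∧ e.impression = {x}) ∧
    (∃ Φ : PrimeEnds.PrimeEndClosure Ω ≃ₜ PrimeEnds.MazurkiewiczClosure Ω,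
      ∀ x : Ω, Φ (PrimeEnds.PrimeEndClosure.ofPoint x) =
        PrimeEnds.MazurkiewiczClosure.ofPoint x) ∧
    ((∀ x ∈ frontier Ω, p ∈ PrimeEnds.dimSet μ x ∧ PrimeEnds.dimSet μ x ≠ Ioc 0 1) →
      {e : PrimeEnds.DomainEnd Ω | e.IsPrime} =
        {e : PrimeEnds.DomainEnd Ω | e.IsModPrime μ p}) ∧
    (TopologicalSpace.MetrizableSpace (PrimeEnds.PrimeEndClosure Ω) ∧
      CompactSpace (PrimeEnds.PrimeEndClosure Ω)) := by
  have hproper : ProperSpace X := hdoubling.properSpace hball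
  have hpath : LocallyPathConnectedSpace X :=
    hpoincare.locallyPathConnectedSpace (one_pos.trans_le hp) hball hdoubling
  have hcompact : CompactSpace (PrimeEnds.MazurkiewiczClosure Ω) :=
    PrimeEnds.MazurkiewiczClosure.compactSpace_of_totallyBounded
      (PrimeEnds.totallyBounded_mazurkiewicz hΩ)
  have hopen : IsOpen Ω := hΩ.1.1
  obtain ⟨Φ, hΦ⟩ := PrimeEnds.PrimeEndClosure.exists_homeomorph_mazurkiewiczClosure hopen
  refine ⟨PrimeEnds.DomainEnd.exists_isPrime_divides hopen,
    fun e he => he.exists_impression_eq hopen, fun x hx => ?_, ⟨Φ, hΦ⟩,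
    fun hdim => Set.ext fun e =>
      PrimeEnds.DomainEnd.isPrime_iff_isModPrime hopen hp hball hdim,
    Φ.isEmbedding.metrizableSpace, Φ.symm.compactSpace⟩
  obtain ⟨E, m, hE, hEopen, hEx⟩ := PrimeEnds.exists_represents_of_mem_frontier hopen hx
  obtain rfl := singleton_injective (hE.impression_eq.symm.trans hEx)
  exact ⟨PrimeEnds.isAccessible_of_isOpen_chain hEopen hx
    fun V hV => hE.exists_subset_of_mem_nhds hV, PrimeEnds.DomainEnd.mk E, hE.isPrime hopen, hEx⟩
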